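/- **Setting.** All parameters are functions of $p\to\infty$. Let $n,s_0,r\in\mathbb N$, $\epsilon>0$, $\delta\in(0,1)$. Let $\mathcal D$ be a fixed probability distribution on $[-b,b]$ with mean $0$ and variance $1$, let $\sigma>0$ with $\sigma=\Theta(1)$, and let $b_n$ satisfy $b_n=O(\sigma\sqrt{\log n})$ and $b_n/\sigma-\sqrt{2\log(2n)}\to\infty$. Let $\theta_0\in\mathbb R^p$ have exactly $s_0$ non-zero entries and $\|\theta_0\|_2=1$. Let $X\in\mathbb R^{n\times p}$ have entries of law $\mathcal D$, let $\xi\in\mathbb R^n$ have entries distributed as $\mathcal N(0,\sigma^2)$ conditioned on $[-b_n,b_n]$, and let $R=[R_1\,R_2\,R_3]\in\mathbb R^{r\times(n+p+1)}$ have entries of law $\mathcal N(0,1/r)$, all these entries being mutually independent. Put $y=X\theta_0+\xi$ and $$B^2=2pb^2+(b\sqrt{s_0}+b_n)^2,\qquad w^2=\frac{4B^2}{\epsilon}\Big(\sqrt{2r\log(4/\delta)}+\log(4/\delta)\Big),\quad w\ge 0,\qquad [X^*\ y^*]=R\begin{bmatrix}X\ \ y\\ wI_{p+1}\end{bmatrix}.$$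 For a constant $C_\lambda>0$ put $$\lambda=C_\lambda\,\sigma\max\Big\{\sqrt{\tfrac{\log p}{n}},\sqrt{\tfrac{(\log p)^3}{r}}\Big\},\quad \rho_n^2=\frac{n+r+1}{nr}+\frac{w^2}{nr},\quad \phi_w=1+\frac{w^2}{n},\quad \kappa_n=2\lambda\sqrt{s_0}+\frac{w^2}{n},$$ let $\widehat\theta^*$ be a minimizer over $\theta\in\mathbb R^p$ of $\frac1{2n}\|X^*\theta-y^*\|_2^2+\lambda\|\theta\|_1$, and let $$\Delta=\Big(\tfrac1nX^\top X-I_p\Big)(\theta_0-\widehat\theta^*)+\tfrac1n[X^\top\ wI_p\ \mathbf 0]\,(R^\top R-I_{n+p+1})\begin{bmatrix}X(\theta_0-\widehat\theta^*)\\-w\widehat\theta^*\\ w\end{bmatrix}$$ be the bias term of the debiased private Lasso. **Statement.** There is an absolute constant $C_\lambda>0$ such that the following holds. Let $c_0\in(0,1)$, $\alpha>2$, $\alpha+\gamma>3$, let $n=p^\alpha$ and $s_0=c_0p$ (up to rounding to an integer, i.e. up to an error of at most $1$), let $\epsilon=p^\gamma$ and $\log(1/\delta)=O(\log p)$. Then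 there is a choice of $r=r(p)\to\infty$, depending only on these parameters (and not on $\mathcal D,b,\sigma,b_n,\theta_0$), such that for all $\mathcal D,b,\sigma,b_n$ as above the four conditions 1. $\dfrac{\kappa_n^2}{\lambda^2\phi_w}=o\Big(\sqrt{\tfrac{n}{\log p}}\,\min\big\{1,\sqrt{\tfrac rn},\tfrac{\sqrt{rn}}{w^2}\big\}\Big)$, 2. $\sqrt{s_0}=O\Big(\max\big\{\tfrac1{\sqrt n},\tfrac{\log p}{\sqrt r}\big\}\Big/\max\big\{\tfrac{w\log p}{\sqrt{nr}},\tfrac{w^2}{n}\sqrt{\tfrac{\log p}{r}}\big\}\Big)$, 3. $\dfrac{\sqrt{s_0}}{\sigma\rho_n}=o\Big(\min\big\{\tfrac n{w^2}\sqrt{\tfrac r{\log p}},\tfrac{\sqrt{nr}}{w\log p}\big\}\Big)$, 4. $\dfrac{1}{\sigma\rho_n}\dfrac{4\kappa_n^2}{\lambda\phi_w}=o\Big(\min\big\{\sqrt{\tfrac n{\log p}},\sqrt{\tfrac r{\log p}},\tfrac n{w^2}\sqrt{\tfrac r{\log p}},\tfrac{\sqrt{nr}}{w\log p}\big\}\Big)$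 hold as $p\to\infty$, and moreover, for every sequence $\theta_0$ as above and every choice of the minimizers $\widehat\theta^*$, $\|\Delta\|_\infty=o_p(\sigma\rho_n)$, that is, $\lim_{p\to\infty}\mathbb P\big(\|\Delta\|_\infty/(\sigma\rho_n)>\eta\big)=0$ for every $\eta>0$. -/

import Mathlib

open MeasureTheory ProbabilityTheory Filter Asymptotics
open scoped Topology NNReal

noncomputable section

namespace JLDebias

/-! ### Scalar parameters -/

/-- The bound `B` on the Euclidean norm of the data rows. -/
def rowBound (p s₀ : ℕ) (b bn : ℝ) : ℝ :=
  √(2 * p * b ^ 2 + (b * √(s₀ : ℝ) + bn) ^ 2)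

/-- The privacy parameter `w`,
with `w² = (4 B² / ε) (√(2 r log (4/δ)) + log (4/δ))`. -/
def privacyW (B ε δ : ℝ) (r : ℕ) : ℝ :=
  √(4 * B ^ 2 / ε * (√(2 * r * Real.log (4 / δ)) + Real.log (4 / δ)))

/-- The noise level `ρ`, with `ρ² = (n + r + 1) / (n r) + w² / (n r)`. -/
def rho (n r : ℕ) (w : ℝ) : ℝ :=
  √(((n : ℝ) + r + 1) / (n * r) + w ^ 2 / (n * r))

/-- The Lasso penalty `λ = C σ max {√(log p / n), √((log p)³ / r)}`. -/
def penalty (C σ : ℝ) (n p r : ℕ) : ℝ :=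
  C * σ * max √(Real.log p / n) √(Real.log p ^ 3 / r)

/-- `φ_w = 1 + w² / n`. -/
def phiW (n : ℕ) (w : ℝ) : ℝ := 1 + w ^ 2 / n

/-- `κ = 2 λ √s₀ + w² / n`. -/
def kappa (lam : ℝ) (n s₀ : ℕ) (w : ℝ) : ℝ := 2 * lam * √(s₀ : ℝ) + w ^ 2 / n

/-! ### Private data, private Lasso, bias term

The columns of the projection matrix `R` are indexed by `Fin n ⊕ (Fin p ⊕ Unit)`, which is the
split `R = [R₁ R₂ R₃]`. -/

/-- The privatized data `[X* y*] = R [X y; w I_{p+1}]`. -/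
def privateData {n p r : ℕ} (w : ℝ) (X : Matrix (Fin n) (Fin p) ℝ) (y : Fin n → ℝ)
    (R : Matrix (Fin r) (Fin n ⊕ (Fin p ⊕ Unit)) ℝ) : Matrix (Fin r) (Fin p ⊕ Unit) ℝ :=
  R * Matrix.fromRows (Matrix.fromCols X (Matrix.replicateCol Unit y))
    (w • (1 : Matrix (Fin p ⊕ Unit) (Fin p ⊕ Unit) ℝ))

/-- The private design matrix `X*`. -/
def privateX {n p r : ℕ} (w : ℝ) (X : Matrix (Fin n) (Fin p) ℝ) (y : Fin n → ℝ)
    (R : Matrix (Fin r) (Fin n ⊕ (Fin p ⊕ Unit)) ℝ) : Matrix (Fin r) (Fin p) ℝ :=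
  (privateData w X y R).toCols₁

/-- The private response `y*`. -/
def privateY {n p r : ℕ} (w : ℝ) (X : Matrix (Fin n) (Fin p) ℝ) (y : Fin n → ℝ)
    (R : Matrix (Fin r) (Fin n ⊕ (Fin p ⊕ Unit)) ℝ) : Fin r → ℝ :=
  fun k => privateData w X y R k (Sum.inr ())

/-- The objective `(1 / 2n) ‖A θ - v‖₂² + λ ‖θ‖₁`. -/
def lassoObjective {p r : ℕ} (n : ℕ) (lam : ℝ) (A : Matrix (Fin r) (Fin p) ℝ)
    (v : Fin r → ℝ) (θ : Fin p → ℝ) : ℝ :=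
  1 / (2 * n) * ∑ k, (A.mulVec θ k - v k) ^ 2 + lam * ∑ j, |θ j|

/-- `θ` is a private Lasso estimate: a minimizer of the Lasso objective of `(X*, y*)`. -/
def IsPrivateLasso {n p r : ℕ} (lam w : ℝ) (X : Matrix (Fin n) (Fin p) ℝ) (y : Fin n → ℝ)
    (R : Matrix (Fin r) (Fin n ⊕ (Fin p ⊕ Unit)) ℝ) (θ : Fin p → ℝ) : Prop :=
  ∀ θ' : Fin p → ℝ, lassoObjective n lam (privateX w X y R) (privateY w X y R) θ ≤
    lassoObjective n lam (privateX w X y R) (privateY w X y R) θ'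

/-- The augmented design `[X; w I_p; 0]`. -/
def augmentedDesign {n p : ℕ} (w : ℝ) (X : Matrix (Fin n) (Fin p) ℝ) :
    Matrix (Fin n ⊕ (Fin p ⊕ Unit)) (Fin p) ℝ :=
  Matrix.fromRows X
    (Matrix.fromRows (w • (1 : Matrix (Fin p) (Fin p) ℝ)) (0 : Matrix Unit (Fin p) ℝ))

/-- The bias term
`Δ = (XᵀX/n - I)(θ₀ - θ) + (1/n) [Xᵀ wI 0] (RᵀR - I) [X(θ₀ - θ); -wθ; w]`. -/
def bias {n p r : ℕ} (w : ℝ) (X : Matrix (Fin n) (Fin p) ℝ)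
    (R : Matrix (Fin r) (Fin n ⊕ (Fin p ⊕ Unit)) ℝ) (θ₀ θ : Fin p → ℝ) : Fin p → ℝ :=
  Matrix.mulVec ((1 / (n : ℝ)) • (X.transpose * X) - (1 : Matrix (Fin p) (Fin p) ℝ)) (θ₀ - θ) +
    (1 / (n : ℝ)) •
      Matrix.mulVec (augmentedDesign w X).transpose
        (Matrix.mulVec
          (R.transpose * R -
            (1 : Matrix (Fin n ⊕ (Fin p ⊕ Unit)) (Fin n ⊕ (Fin p ⊕ Unit)) ℝ))
          (Sum.elim (X.mulVec (θ₀ - θ)) (Sum.elim (-(w • θ)) (fun _ : Unit => w))))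

/-! ### The random model -/

/-- The law of `N(0, σ²)` conditioned on `[-a, a]`. -/
def truncatedGaussian (σ a : ℝ) : Measure ℝ :=
  ProbabilityTheory.cond (gaussianReal 0 (Real.toNNReal (σ ^ 2))) (Set.Icc (-a) a)

/-- The random design `X`, the noise `ξ` and the projection matrix `R` have mutually independent
entries, with laws `D`, truncated Gaussian, and `N(0, 1/r)` respectively. -/
structure IsModel {Ω : Type*} [MeasurableSpace Ω] (μ : Measure Ω) {n p r : ℕ}
    (D : Measure ℝ) (σ bn : ℝ) (X : Ω → Matrix (Fin n) (Fin p) ℝ) (ξ : Ω → Fin n → ℝ)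
    (R : Ω → Matrix (Fin r) (Fin n ⊕ (Fin p ⊕ Unit)) ℝ) : Prop where
  law_X : ∀ i j, HasLaw (fun ω => X ω i j) D μ
  law_ξ : ∀ i, HasLaw (fun ω => ξ ω i) (truncatedGaussian σ bn) μ
  law_R : ∀ k l, HasLaw (fun ω => R ω k l) (gaussianReal 0 (1 / (r : ℝ≥0))) μ
  indep : iIndepFun
    (Sum.elim (fun (ij : Fin n × Fin p) ω => X ω ij.1 ij.2)
      (Sum.elim (fun (i : Fin n) ω => ξ ω i)
        (fun (kl : Fin r × (Fin n ⊕ (Fin p ⊕ Unit))) ω => R ω kl.1 kl.2))) μ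

/-! ### The sufficient conditions for debiasing, for sequences indexed by `p` -/

/-- The four growth conditions on the parameters, as `p → ∞`. -/
structure SufficientConditions (C : ℝ) (σ : ℕ → ℝ) (n s₀ r : ℕ → ℕ) (w : ℕ → ℝ) : Prop where
  compatibility :
    (fun p : ℕ => kappa (penalty C (σ p) (n p) p (r p)) (n p) (s₀ p) (w p) ^ 2 /
        (penalty C (σ p) (n p) p (r p) ^ 2 * phiW (n p) (w p)))
      =o[atTop] fun p : ℕ => √((n p : ℝ) / Real.log p) *
        min 1 (min √((r p : ℝ) / n p) (√((r p : ℝ) * n p) / w p ^ 2))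
  penalty_level :
    (fun p : ℕ => √(s₀ p : ℝ))
      =O[atTop] fun p : ℕ => max (1 / √(n p : ℝ)) (Real.log p / √(r p : ℝ)) /
        max (w p * Real.log p / √((n p : ℝ) * r p))
          (w p ^ 2 / n p * √(Real.log p / r p))
  sparsity :
    (fun p : ℕ => 1 / (σ p * rho (n p) (r p) (w p)) * √(s₀ p : ℝ))
      =o[atTop] fun p : ℕ => min ((n p : ℝ) / w p ^ 2 * √((r p : ℝ) / Real.log p))
        (√((n p : ℝ) * r p) / (w p * Real.log p))
  error :
    (fun p : ℕ => 1 / (σ p * rho (n p) (r p) (w p)) *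
        (4 * kappa (penalty C (σ p) (n p) p (r p)) (n p) (s₀ p) (w p) ^ 2 /
          (penalty C (σ p) (n p) p (r p) * phiW (n p) (w p))))
      =o[atTop] fun p : ℕ => min √((n p : ℝ) / Real.log p)
        (min √((r p : ℝ) / Real.log p)
          (min ((n p : ℝ) / w p ^ 2 * √((r p : ℝ) / Real.log p))
            (√((n p : ℝ) * r p) / (w p * Real.log p))))

end JLDebias

end

/-! The projection dimension r is chosen so large that no sparsity argument is needed. Take r =
⌈p^(2+τ)⌉ with 2 + τ < α and 2τ ≤ α + γ - 3. Then r ≤ n eventually, and two quantities vanish: p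
(log p)³ / √r, because r exceeds p² by a power of p, and √r w² / n, because w² is at most of order
p^(1-γ) √r log p. Their geometric mean controls a third, log p · √p · w / √n. Each of the four
growth conditions reduces to one of these limits.

For the bias, let A = [X; wI; 0]. Both the private Gram matrix and the bias are governed by XᵀX - nI
and by the form uᵀ(RᵀR - I)v on finitely many test vectors. Hoeffding's inequality and a bilinear
Johnson–Lindenstrauss bound, each at deviation level log p, make all of these small outside an event
of probability poly(p) · exp(-(log p)²/16) (`IsModel.measure_not_isGood_le`).

On the good event the private Gram matrix is (1 + w²/n) I up to an entrywise error e of order log p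
/ √r. As p e is small, the matrix is positive definite in every direction, not merely on a cone, and
the basic inequality yields ‖θ₀ - θ̂‖₁ ≤ 4p(N + λ), where N bounds the private score
(`sum_abs_le_of_quadratic_le`). Since [X(θ₀ - θ̂); -wθ̂; w] = A(θ₀ - θ̂) + [0; -wθ₀; w], the bias is
at most e ‖θ₀ - θ̂‖₁ plus one Johnson–Lindenstrauss error of order (log p / √r)(w / √n)
(`IsGood.norm_bias_le`). With N and λ of order (log p)² / √r and ρ ≥ 1/√r, the ratio to σρ is
controlled by the vanishing quantities above (`Regime.norm_bias_div_le`). -/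

namespace JLDebias

/-! ### Moment generating function of a squared Gaussian -/

lemma integral_exp_mul_sq_gaussianReal (v : ℝ≥0) {s : ℝ} (hs : 2 * s * v < 1) :
    ∫ x, Real.exp (s * x ^ 2) ∂(gaussianReal 0 v) = (√(1 - 2 * s * v))⁻¹ := by
  rcases eq_or_ne v 0 with rfl | hv
  · simp
  have hv' : (0 : ℝ) < v := by positivity
  have hb : 0 < 1 / (2 * (v : ℝ)) - s := by
    rw [sub_pos, lt_div_iff₀ (by positivity)]; linarith
  rw [integral_gaussianReal_eq_integral_smul hv]
  have : ∀ x : ℝ, gaussianPDFReal 0 v x • Real.exp (s * x ^ 2)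
      = (√(2 * Real.pi * v))⁻¹ * Real.exp (-(1 / (2 * (v : ℝ)) - s) * x ^ 2) := by
    intro x
    rw [gaussianPDFReal, smul_eq_mul, mul_assoc, ← Real.exp_add]
    congr 2
    field_simp
    ring
  simp_rw [this]
  rw [integral_const_mul, integral_gaussian, ← Real.sqrt_inv, ← Real.sqrt_inv,
    ← Real.sqrt_mul (by positivity)]
  congr 1
  have h2 : 1 - 2 * s * (v : ℝ) ≠ 0 := by linarith
  have h3 : 1 / (2 * (v : ℝ)) - s = (1 - 2 * s * v) / (2 * v) := by field_simp
  rw [h3]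
  field_simp

/-- The Bochner integral of a non-integrable function is 0, whereas the value just computed is
positive. -/
lemma integrable_exp_mul_sq_gaussianReal (v : ℝ≥0) {s : ℝ} (hs : 2 * s * v < 1) :
    Integrable (fun x => Real.exp (s * x ^ 2)) (gaussianReal 0 v) := by
  by_contra h
  have h1 := integral_exp_mul_sq_gaussianReal v hs
  rw [integral_undef h] at h1
  have : 0 < (√(1 - 2 * s * v))⁻¹ := by
    have : 0 < 1 - 2 * s * (v : ℝ) := by linarith
    positivity
  linarith

/-- First-order Taylor bound |log(1 - x) + x| ≤ x² / (1 - |x|) at x = 2y; since |x| ≤ 1/2 the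
remainder is at most 8y², and the square root halves it. -/
lemma inv_sqrt_one_sub_le_exp {y : ℝ} (hy : |y| ≤ 1 / 4) :
    (√(1 - 2 * y))⁻¹ ≤ Real.exp (y + 4 * y ^ 2) := by
  have hz : |2 * y| ≤ 1 / 2 := by rw [abs_mul, abs_two]; linarith
  have h := Real.abs_log_sub_add_sum_range_le (x := 2 * y) (by linarith) 1
  simp only [Finset.range_one, Finset.sum_singleton, zero_add, pow_one, Nat.cast_zero, div_one,
    Nat.reduceAdd, sq_abs] at h
  have hpos : 0 < 1 - 2 * y := by have := abs_le.1 hy; linarith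
  have h2 : (2 * y) ^ 2 / (1 - |2 * y|) ≤ 8 * y ^ 2 := by
    rw [div_le_iff₀ (by linarith)]
    nlinarith [sq_nonneg y]
  have h3 := (abs_le.1 (h.trans h2)).1
  rw [← Real.exp_log (Real.sqrt_pos.2 hpos), ← Real.exp_neg, Real.log_sqrt hpos.le]
  apply Real.exp_le_exp.2
  linarith

lemma integral_exp_mul_sq_gaussianReal_le (v : ℝ≥0) {s : ℝ} (hs : |s * v| ≤ 1 / 4) :
    ∫ x, Real.exp (s * (x ^ 2 - v)) ∂(gaussianReal 0 v) ≤ Real.exp (4 * (s * v) ^ 2) := by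
  have h1 : ∀ x : ℝ, Real.exp (s * (x ^ 2 - v)) = Real.exp (-(s * v)) * Real.exp (s * x ^ 2) := by
    intro x
    rw [← Real.exp_add]; ring_nf
  simp_rw [h1]
  rw [integral_const_mul, integral_exp_mul_sq_gaussianReal v (by linarith [(abs_le.1 hs).2])]
  have := inv_sqrt_one_sub_le_exp hs
  rw [mul_assoc 2]
  calc _ ≤ Real.exp (-(s * v)) * Real.exp (s * v + 4 * (s * v) ^ 2) := by gcongr
    _ = _ := by rw [← Real.exp_add]; ring_nf

/-! ### Concentration of sums of squared Gaussians -/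

section Tail

variable {Ω : Type*} [MeasurableSpace Ω] {μ : Measure Ω} {ι : Type*} [Fintype ι]

lemma mgf_sq_sub_le {g : Ω → ℝ} {v : ℝ≥0} (hg : HasLaw g (gaussianReal 0 v) μ)
    {s : ℝ} (hs : |s * v| ≤ 1 / 4) :
    mgf (fun ω => g ω ^ 2 - v) μ s ≤ Real.exp (4 * (s * v) ^ 2) := by
  have : mgf (fun ω => g ω ^ 2 - v) μ s
      = ∫ x, Real.exp (s * (x ^ 2 - v)) ∂(gaussianReal 0 v) := by
    rw [mgf, ← hg.integral_comp (f := fun x => Real.exp (s * (x ^ 2 - v)))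
      (by fun_prop)]
    rfl
  rw [this]
  exact integral_exp_mul_sq_gaussianReal_le v hs

lemma integrable_exp_mul_sq_sub {g : Ω → ℝ} {v : ℝ≥0} (hg : HasLaw g (gaussianReal 0 v) μ)
    {s : ℝ} (hs : |s * v| ≤ 1 / 4) :
    Integrable (fun ω => Real.exp (s * (g ω ^ 2 - v))) μ := by
  have h0 : Integrable (fun x => Real.exp (s * (x ^ 2 - v))) (gaussianReal 0 v) := by
    have h1 : ∀ x : ℝ, Real.exp (s * (x ^ 2 - v))
        = Real.exp (-(s * v)) * Real.exp (s * x ^ 2) := by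
      intro x
      rw [← Real.exp_add]; ring_nf
    simp_rw [h1]
    exact (integrable_exp_mul_sq_gaussianReal v (by linarith [(abs_le.1 hs).2])).const_mul _
  rw [← hg.map_eq] at h0
  exact h0.comp_aemeasurable hg.aemeasurable

/-- Chi-square tail bound. -/
lemma measure_lt_abs_sum_sq_sub_le {g : ι → Ω → ℝ} {v : ℝ≥0} (hind : iIndepFun g μ)
    (hm : ∀ i, Measurable (g i)) (hg : ∀ i, HasLaw (g i) (gaussianReal 0 v) μ) {t : ℝ} (ht0 : 0 ≤ t) (ht1 : t ≤ 1) :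
    μ.real {ω | t * (Fintype.card ι * v) < |∑ i, (g i ω ^ 2 - v)|}
      ≤ 2 * Real.exp (-(Fintype.card ι * t ^ 2 / 16)) := by
  have := hind.isProbabilityMeasure
  set N : ℝ := ((Fintype.card ι : ℕ) : ℝ) with hN
  have hNn : 0 ≤ N := by positivity
  -- The Chernoff parameter below divides by v. For v = 0 the variables vanish almost surely, and
  -- strictness of the inequality makes the event null.
  rcases eq_or_ne v 0 with rfl | hv
  · have hz : ∀ᵐ ω ∂μ, ∀ i, g i ω = 0 := by
      rw [ae_all_iff]
      intro i
      have := hg i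
      rw [gaussianReal_zero_var] at this
      exact this.ae_eq_of_dirac
    have : μ.real {ω | t * (N * (0 : ℝ≥0)) < |∑ i, (g i ω ^ 2 - (0 : ℝ≥0))|} = 0 := by
      rw [measureReal_def, measure_eq_zero_iff_ae_notMem.2, ENNReal.toReal_zero]
      filter_upwards [hz] with ω hω
      simp [hω]
    rw [this]
    positivity
  have hv' : (0 : ℝ) < v := by positivity
  set Y : ι → Ω → ℝ := fun i ω => g i ω ^ 2 - v with hY
  have hYind : iIndepFun Y μ := hind.comp (fun _ x => x ^ 2 - v) (by fun_prop)
  have hYm : ∀ i, Measurable (Y i) := fun i => ((hm i).pow_const 2).sub_const _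
  have key : ∀ s : ℝ, |s * v| ≤ 1 / 4 →
      mgf (∑ i, Y i) μ s ≤ Real.exp (N * (4 * (s * v) ^ 2)) := by
    intro s hs
    rw [hYind.mgf_sum hYm]
    calc _ ≤ ∏ _i : ι, Real.exp (4 * (s * v) ^ 2) :=
          Finset.prod_le_prod (fun i _ => mgf_nonneg) fun i _ => mgf_sq_sub_le (hg i) hs
      _ = _ := by
          rw [Finset.prod_const, Finset.card_univ, ← Real.exp_nat_mul]
  have keyint : ∀ s : ℝ, |s * v| ≤ 1 / 4 →
      Integrable (fun ω => Real.exp (s * (∑ i, Y i) ω)) μ := by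
    intro s hs
    exact hYind.integrable_exp_mul_sum hYm fun i _ => integrable_exp_mul_sq_sub (hg i) hs
  -- Minimizer of the Chernoff exponent -s t N v + 4N (s v)², with value -N t² / 16; t ≤ 1 keeps s v
  -- within the range of the moment bound.
  set s : ℝ := t / (8 * v) with hs
  have hsv : s * v = t / 8 := by rw [hs]; field_simp
  have hs1 : |s * v| ≤ 1 / 4 := by rw [hsv, abs_le]; constructor <;> linarith
  have hs2 : |(-s) * v| ≤ 1 / 4 := by rw [neg_mul, abs_neg]; exact hs1
  have hs0 : 0 ≤ s := by positivity
  have hup := measure_ge_le_exp_mul_mgf (t * (N * v)) hs0 (keyint s hs1)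
  have hlo := measure_le_le_exp_mul_mgf (-(t * (N * v))) (by linarith : -s ≤ 0) (keyint (-s) hs2)
  have e1 : -s * (t * (N * v)) = -(N * t ^ 2 / 8) := by
    have : -s * (t * (N * v)) = -(N * t * (s * v)) := by ring
    rw [this, hsv]; ring
  have b1 : μ.real {ω | t * (N * v) ≤ (∑ i, Y i) ω} ≤ Real.exp (-(N * t ^ 2 / 16)) := by
    refine hup.trans ?_
    calc _ ≤ Real.exp (-s * (t * (N * v))) * Real.exp (N * (4 * (s * v) ^ 2)) := by
          gcongr; exact key s hs1
      _ = _ := by rw [← Real.exp_add, e1, hsv]; ring_nf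
  have b2 : μ.real {ω | (∑ i, Y i) ω ≤ -(t * (N * v))} ≤ Real.exp (-(N * t ^ 2 / 16)) := by
    refine hlo.trans ?_
    calc _ ≤ Real.exp (- -s * -(t * (N * v))) * Real.exp (N * (4 * (-s * v) ^ 2)) := by
          gcongr; exact key _ hs2
      _ = _ := by
          rw [← Real.exp_add, show - -s * -(t * (N * v)) = -s * (t * (N * v)) by ring, e1,
            show (-s * v) ^ 2 = (s * v) ^ 2 by ring, hsv]
          ring_nf
  calc _ ≤ μ.real ({ω | t * (N * v) ≤ (∑ i, Y i) ω} ∪ {ω | (∑ i, Y i) ω ≤ -(t * (N * v))}) := by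
        apply measureReal_mono _ (by finiteness)
        intro ω hω
        simp only [Set.mem_ofPred_eq, Set.mem_union, Finset.sum_apply] at hω ⊢
        rcases lt_abs.1 hω with h | h
        · left; exact h.le
        · right; simp only [hY]; linarith
    _ ≤ _ := (measureReal_union_le _ _).trans (by linarith)

end Tail

/-! ### Linear combinations of independent Gaussians -/

section Blocks

variable {Ω : Type*} [MeasurableSpace Ω] {μ : Measure Ω}

/-- Identifies the law of one row of the projection applied to a fixed vector. The induction starts
from the Dirac mass, which is the Gaussian of variance 0. -/
lemma hasLaw_sum_mul_gaussianReal {κ : Type*} [Fintype κ] {Y : κ → Ω → ℝ} {v : ℝ≥0}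
    (hind : iIndepFun Y μ) (hY : ∀ l, HasLaw (Y l) (gaussianReal 0 v) μ) (u : κ → ℝ) :
    HasLaw (fun ω => ∑ l, Y l ω * u l)
      (gaussianReal 0 (v * ∑ l, Real.toNNReal (u l ^ 2))) μ := by
  classical
  have := hind.isProbabilityMeasure
  have hYu : ∀ l, HasLaw (fun ω => Y l ω * u l) (gaussianReal 0 (v * Real.toNNReal (u l ^ 2))) μ := by
    intro l
    have := gaussianReal_mul_const (hY l) (u l)
    convert this using 2
    · simp
    · rw [mul_comm]; congr 1
      ext; simp [sq_nonneg]
  have hind' : iIndepFun (fun l ω => Y l ω * u l) μ :=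
    hind.comp (fun l x => x * u l) (by fun_prop)
  suffices h : ∀ S : Finset κ, HasLaw (fun ω => ∑ l ∈ S, Y l ω * u l)
      (gaussianReal 0 (v * ∑ l ∈ S, Real.toNNReal (u l ^ 2))) μ from h Finset.univ
  intro S
  induction S using Finset.induction_on with
  | empty =>
    simp only [Finset.sum_empty, mul_zero, gaussianReal_zero_var]
    exact hasLaw_dirac_of_ae_eq (ae_of_all _ fun _ => rfl)
  | insert a S ha ih =>
    have hi : IndepFun (fun ω => ∑ l ∈ S, Y l ω * u l) (fun ω => Y a ω * u a) μ := by
      have := hind'.indepFun_finsetSum_of_notMem₀ (fun i => (hYu i).aemeasurable) ha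
      convert this using 1
      ext ω; simp
    refine ⟨?_, ?_⟩
    · exact Finset.aemeasurable_fun_sum _ fun l _ => (hYu l).aemeasurable
    · have := gaussianReal_add_gaussianReal_of_indepFun hi ih.map_eq (hYu a).map_eq
      rw [Finset.sum_insert ha, mul_add, add_comm (v * _)]
      rw [add_zero] at this
      rw [← this]
      congr 1
      ext ω
      simp [Finset.sum_insert ha, add_comm]

/-- Disjoint blocks of an independent family are independent. -/
lemma iIndepFun_curry {ι κ : Type*} [Fintype ι] [Fintype κ] {f : ι × κ → Ω → ℝ}
    (hind : iIndepFun f μ) (hf : ∀ i, AEMeasurable (f i) μ) :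
    iIndepFun (fun i ω j => f (i, j) ω) μ := by
  have := hind.isProbabilityMeasure
  have hm : ∀ i, AEMeasurable (fun ω j => f (i, j) ω) μ := fun i =>
    aemeasurable_pi_lambda _ fun j => hf (i, j)
  have hp : ∀ q, IsProbabilityMeasure (μ.map (f q)) := fun q =>
    Measure.isProbabilityMeasure_map (hf q)
  rw [iIndepFun_iff_map_fun_eq_pi_map hm]
  have h1 := hind.map_fun_eq_pi_map hf
  have h2 : ∀ i, μ.map (fun ω j => f (i, j) ω) = Measure.pi fun j => μ.map (f (i, j)) := fun i =>
    (hind.precomp (g := fun j => (i, j)) (Prod.mk_right_injective i)).map_fun_eq_pi_map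
      fun j => hf (i, j)
  simp_rw [h2]
  -- The joint law is a product measure over pairs, and currying carries it to a product over the
  -- first index of product measures, which is independence of the blocks.
  have h3 := Measure.infinitePi_map_curry (ι := ι) (κ := κ) (X := ℝ) (fun i j => μ.map (f (i, j)))
  simp_rw [Measure.infinitePi_eq_pi] at h3
  rw [← h3, ← h1, AEMeasurable.map_map_of_aemeasurable]
  · rfl
  · exact (MeasurableEquiv.measurable _).aemeasurable
  · exact aemeasurable_pi_lambda _ hf

end Blocks

/-! ### Johnson–Lindenstrauss bounds for Gaussian matrices -/

section JL

variable {r : ℕ} {L : Type*} [Fintype L]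

/-- The r coordinates of R u are independent N(0, |u|²/r) variables, so this is the chi-square bound
with r terms. -/
lemma measure_lt_abs_sq_norm_sub_le (hr : 0 < r) (u : L → ℝ) {t : ℝ} (ht0 : 0 ≤ t) (ht1 : t ≤ 1) :
    (Measure.pi fun _ : Fin r × L => gaussianReal 0 (1 / (r : ℝ≥0))).real
      {R | t * (u ⬝ᵥ u) < |∑ k, (∑ l, R (k, l) * u l) ^ 2 - u ⬝ᵥ u|}
      ≤ 2 * Real.exp (-(r * t ^ 2 / 16)) := by
  set γ := Measure.pi fun _ : Fin r × L => gaussianReal 0 (1 / (r : ℝ≥0)) with hγ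
  have hent : iIndepFun (fun (q : Fin r × L) (R : Fin r × L → ℝ) => R q) γ :=
    iIndepFun_pi (X := fun _ x => x) fun _ => aemeasurable_id
  have hlaw : ∀ q : Fin r × L, HasLaw (fun R : Fin r × L → ℝ => R q)
      (gaussianReal 0 (1 / (r : ℝ≥0))) γ := fun q =>
    ⟨(measurable_pi_apply q).aemeasurable, (measurePreserving_eval _ q).map_eq⟩
  have hrow := iIndepFun_curry hent fun q => (measurable_pi_apply q).aemeasurable
  set v : ℝ≥0 := 1 / (r : ℝ≥0) * ∑ l, Real.toNNReal (u l ^ 2) with hv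
  have hg : iIndepFun (fun (k : Fin r) (R : Fin r × L → ℝ) => ∑ l, R (k, l) * u l) γ :=
    hrow.comp (fun _ x => ∑ l, x l * u l) (by fun_prop)
  have hgl : ∀ k : Fin r, HasLaw (fun R : Fin r × L → ℝ => ∑ l, R (k, l) * u l)
      (gaussianReal 0 v) γ := fun k =>
    hasLaw_sum_mul_gaussianReal
      (hent.precomp (g := fun l => (k, l)) (Prod.mk_right_injective k))
      (fun l => hlaw (k, l)) u
  have hvu : (r : ℝ) * v = u ⬝ᵥ u := by
    have : (r : ℝ) ≠ 0 := by positivity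
    simp only [hv, one_div, NNReal.coe_mul, NNReal.coe_inv, NNReal.coe_natCast, NNReal.coe_sum,
      dotProduct]
    rw [← mul_assoc, mul_inv_cancel₀ this, one_mul]
    exact Finset.sum_congr rfl fun l _ => by rw [Real.coe_toNNReal _ (sq_nonneg _)]; ring
  have := measure_lt_abs_sum_sq_sub_le hg (fun k => by fun_prop) hgl ht0 ht1
  simp only [Fintype.card_fin, Finset.sum_sub_distrib, Finset.sum_const, Finset.card_univ,
    nsmul_eq_mul, hvu] at this
  exact this

/-- The form `uᵀ (RᵀR - I) v`, with the matrix `R` given by its entries. -/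
def jlForm (R : Fin r × L → ℝ) (u v : L → ℝ) : ℝ :=
  ∑ k, (∑ l, R (k, l) * u l) * (∑ l, R (k, l) * v l) - u ⬝ᵥ v

lemma jlForm_smul_smul (R : Fin r × L → ℝ) (u v : L → ℝ) (a c : ℝ) :
    jlForm R (a • u) (c • v) = a * c * jlForm R u v := by
  have h : ∀ (x : ℝ) (z : L → ℝ) (k : Fin r),
      ∑ l, R (k, l) * (x • z) l = x * ∑ l, R (k, l) * z l := by
    intro x z k
    rw [Finset.mul_sum]
    exact Finset.sum_congr rfl fun l _ => by simp only [Pi.smul_apply, smul_eq_mul]; ring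
  simp only [jlForm, h, smul_dotProduct, dotProduct_smul, smul_eq_mul, mul_sub]
  congr 1
  · rw [Finset.mul_sum]
    exact Finset.sum_congr rfl fun k _ => by ring
  · ring

lemma jlForm_polarization (R : Fin r × L → ℝ) (u v : L → ℝ) :
    4 * jlForm R u v = jlForm R (u + v) (u + v) - jlForm R (u - v) (u - v) := by
  have h1 : ∀ k, ∑ l, R (k, l) * (u + v) l = ∑ l, R (k, l) * u l + ∑ l, R (k, l) * v l := by
    intro k; simp [mul_add, Finset.sum_add_distrib]
  have h2 : ∀ k, ∑ l, R (k, l) * (u - v) l = ∑ l, R (k, l) * u l - ∑ l, R (k, l) * v l := by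
    intro k; simp [mul_sub, Finset.sum_sub_distrib]
  simp only [jlForm, h1, h2, mul_sub, Finset.mul_sum, add_dotProduct, dotProduct_add,
    sub_dotProduct, dotProduct_sub, dotProduct_comm v u]
  have h3 : ∀ a c : Fin r → ℝ, ∑ k, 4 * (a k * c k)
      = ∑ k, (a k + c k) * (a k + c k) - ∑ k, (a k - c k) * (a k - c k) := by
    intro a c
    rw [← Finset.sum_sub_distrib]
    exact Finset.sum_congr rfl fun k _ => by ring
  have := h3 (fun k => ∑ l, R (k, l) * u l) (fun k => ∑ l, R (k, l) * v l)
  simp only [← Finset.mul_sum] at this ⊢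
  rw [this]
  ring_nf

lemma jlForm_self (R : Fin r × L → ℝ) (u : L → ℝ) :
    jlForm R u u = ∑ k, (∑ l, R (k, l) * u l) ^ 2 - u ⬝ᵥ u := by
  simp only [jlForm, sq]

/-- Polarization reduces the bilinear form to the quadratic form at u ± v. Normalizing first gives
the product of the norms: for unit vectors the parallelogram law makes the two errors add up to 4t,
which is exactly four times the required bound. -/
lemma measure_lt_abs_jlForm_le (hr : 0 < r) (u v : L → ℝ) {t : ℝ} (ht0 : 0 ≤ t) (ht1 : t ≤ 1) :
    (Measure.pi fun _ : Fin r × L => gaussianReal 0 (1 / (r : ℝ≥0))).real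
      {R | t * (√(u ⬝ᵥ u) * √(v ⬝ᵥ v)) < |jlForm R u v|}
      ≤ 4 * Real.exp (-(r * t ^ 2 / 16)) := by
  have hnn : ∀ z : L → ℝ, 0 ≤ z ⬝ᵥ z := fun z => Finset.sum_nonneg fun l _ => mul_self_nonneg _
  have hz : ∀ z : L → ℝ, √(z ⬝ᵥ z) = 0 → z = 0 := fun z h => by
    rw [Real.sqrt_eq_zero (hnn z)] at h
    exact dotProduct_self_eq_zero.1 h
  -- A zero vector cannot be normalized, but then both sides vanish and the strict inequality never
  -- holds.
  rcases eq_or_ne (√(u ⬝ᵥ u)) 0 with hu | hu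
  · simp only [hz u hu, jlForm]
    simp only [Pi.zero_apply, mul_zero, Finset.sum_const_zero, zero_mul, zero_dotProduct, sub_self,
      Real.sqrt_zero, abs_zero, lt_self_iff_false]
    have : {R : Fin r × L → ℝ | False} = ∅ := rfl
    rw [this, measureReal_empty]; positivity
  rcases eq_or_ne (√(v ⬝ᵥ v)) 0 with hv | hv
  · simp only [hz v hv, jlForm]
    simp only [Pi.zero_apply, mul_zero, Finset.sum_const_zero, dotProduct_zero, sub_self,
      Real.sqrt_zero, abs_zero, lt_self_iff_false]
    have : {R : Fin r × L → ℝ | False} = ∅ := rfl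
    rw [this, measureReal_empty]; positivity
  have hu0 : 0 < √(u ⬝ᵥ u) := lt_of_le_of_ne (Real.sqrt_nonneg _) hu.symm
  have hv0 : 0 < √(v ⬝ᵥ v) := lt_of_le_of_ne (Real.sqrt_nonneg _) hv.symm
  set a := √(u ⬝ᵥ u) with ha
  set c := √(v ⬝ᵥ v) with hc
  set u' := a⁻¹ • u with hu'
  set v' := c⁻¹ • v with hv'
  have huu : u' ⬝ᵥ u' = 1 := by
    rw [hu', smul_dotProduct, dotProduct_smul, smul_eq_mul, smul_eq_mul, ← Real.sq_sqrt (hnn u),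
      ← ha]
    field_simp
  have hvv : v' ⬝ᵥ v' = 1 := by
    rw [hv', smul_dotProduct, dotProduct_smul, smul_eq_mul, smul_eq_mul, ← Real.sq_sqrt (hnn v),
      ← hc]
    field_simp
  have hform : ∀ R : Fin r × L → ℝ, jlForm R u v = a * c * jlForm R u' v' := by
    intro R
    rw [← jlForm_smul_smul, hu', hv', smul_smul, smul_smul, mul_inv_cancel₀ hu,
      mul_inv_cancel₀ hv, one_smul, one_smul]
  have hsub : {R : Fin r × L → ℝ | t * (a * c) < |jlForm R u v|} ⊆
      {R | t * ((u' + v') ⬝ᵥ (u' + v')) <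
        |∑ k, (∑ l, R (k, l) * (u' + v') l) ^ 2 - (u' + v') ⬝ᵥ (u' + v')|} ∪
      {R | t * ((u' - v') ⬝ᵥ (u' - v')) <
        |∑ k, (∑ l, R (k, l) * (u' - v') l) ^ 2 - (u' - v') ⬝ᵥ (u' - v')|} := by
    intro R hR
    by_contra hcon
    simp only [Set.mem_union, Set.mem_ofPred_eq, not_or, not_lt, ← jlForm_self] at hcon hR
    rw [hform, abs_mul, abs_of_pos (mul_pos hu0 hv0), mul_comm t] at hR
    have hR' := lt_of_mul_lt_mul_left hR (mul_pos hu0 hv0).le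
    have hpol := jlForm_polarization R u' v'
    have h4 : |4 * jlForm R u' v'| ≤ 4 * t := by
      rw [hpol]
      refine (abs_sub _ _).trans ((add_le_add hcon.1 hcon.2).trans ?_)
      simp only [add_dotProduct, dotProduct_add, sub_dotProduct, dotProduct_sub, huu, hvv]
      linarith
    rw [abs_mul, abs_of_pos (by norm_num : (0 : ℝ) < 4)] at h4
    linarith
  calc _ ≤ _ := measureReal_mono hsub (by finiteness)
    _ ≤ _ := measureReal_union_le _ _
    _ ≤ _ := by
      have h1 := measure_lt_abs_sq_norm_sub_le hr (u' + v') ht0 ht1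
      have h2 := measure_lt_abs_sq_norm_sub_le hr (u' - v') ht0 ht1
      linarith

/-- The bilinear Johnson–Lindenstrauss bound for random vectors independent of the matrix. -/
lemma measure_lt_abs_jlForm_comp_le {Ω 𝓩 : Type*} [MeasurableSpace Ω] [MeasurableSpace 𝓩]
    {μ : Measure Ω} [IsProbabilityMeasure μ] (hr : 0 < r) {Z : Ω → 𝓩} {R : Ω → Fin r × L → ℝ}
    (hZ : AEMeasurable Z μ)
    (hR : HasLaw R (Measure.pi fun _ : Fin r × L => gaussianReal 0 (1 / (r : ℝ≥0))) μ)
    (hind : IndepFun Z R μ) {u v : 𝓩 → L → ℝ} (hu : Measurable u) (hv : Measurable v)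
    {t : ℝ} (ht0 : 0 ≤ t) (ht1 : t ≤ 1) :
    μ {ω | t * (√(u (Z ω) ⬝ᵥ u (Z ω)) * √(v (Z ω) ⬝ᵥ v (Z ω))) <
        |jlForm (R ω) (u (Z ω)) (v (Z ω))|}
      ≤ ENNReal.ofReal (4 * Real.exp (-(r * t ^ 2 / 16))) := by
  have hp : IsProbabilityMeasure (μ.map Z) := Measure.isProbabilityMeasure_map hZ
  have hjoint := hind.hasLaw_prod ⟨hZ, rfl⟩ hR
  set S : Set (𝓩 × (Fin r × L → ℝ)) := {q | t * (√(u q.1 ⬝ᵥ u q.1) * √(v q.1 ⬝ᵥ v q.1)) <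
        |jlForm q.2 (u q.1) (v q.1)|} with hS
  have hSm : MeasurableSet S := by
    have hu' : ∀ l, Measurable fun q : 𝓩 × (Fin r × L → ℝ) => u q.1 l := fun l =>
      (measurable_pi_apply l).comp (hu.comp measurable_fst)
    have hv' : ∀ l, Measurable fun q : 𝓩 × (Fin r × L → ℝ) => v q.1 l := fun l =>
      (measurable_pi_apply l).comp (hv.comp measurable_fst)
    have hR' : ∀ k, Measurable fun q : 𝓩 × (Fin r × L → ℝ) => q.2 k := fun k =>
      (measurable_pi_apply k).comp measurable_snd
    apply measurableSet_lt
    · simp only [dotProduct]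
      fun_prop
    · simp only [dotProduct, jlForm]
      apply Measurable.abs
      fun_prop
  calc _ = μ ((fun ω => (Z ω, R ω)) ⁻¹' S) := rfl
    _ ≤ (μ.map fun ω => (Z ω, R ω)) S := Measure.le_map_apply hjoint.aemeasurable S
    -- By independence the joint law is a product, so Fubini freezes Z at z and the bound for
    -- deterministic vectors applies to each slice.
    _ = ∫⁻ z, (Measure.pi fun _ : Fin r × L => gaussianReal 0 (1 / (r : ℝ≥0)))
          (Prod.mk z ⁻¹' S) ∂(μ.map Z) := by
        rw [hjoint.map_eq, Measure.prod_apply hSm]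
    _ ≤ ∫⁻ _, ENNReal.ofReal (4 * Real.exp (-(r * t ^ 2 / 16))) ∂(μ.map Z) := by
        refine lintegral_mono fun z => ?_
        rw [← ENNReal.ofReal_toReal (measure_ne_top _ (Prod.mk z ⁻¹' S))]
        exact ENNReal.ofReal_le_ofReal (measure_lt_abs_jlForm_le hr (u z) (v z) ht0 ht1)
    _ = _ := by simp

end JL

/-! ### Hoeffding bounds -/

section Hoeffding

variable {Ω : Type*} [MeasurableSpace Ω] {μ : Measure Ω}

/-- Hoeffding's lemma gives each variable the sub-Gaussian parameter c²; the threshold is scaled so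
that only ℓ survives in the exponent. Two-sidedness comes from applying the one-sided bound also to
-Y. -/
lemma measure_lt_abs_sum_le {n : ℕ} (hn : 0 < n) {Y : Fin n → Ω → ℝ} (hind : iIndepFun Y μ)
    (hm : ∀ i, AEMeasurable (Y i) μ) {c ℓ : ℝ} (hc : 0 < c) (hℓ : 0 ≤ ℓ)
    (hb : ∀ i, ∀ᵐ ω ∂μ, |Y i ω| ≤ c) (h0 : ∀ i, ∫ ω, Y i ω ∂μ = 0) :
    μ {ω | c * ℓ * √n < |∑ i, Y i ω|} ≤ ENNReal.ofReal (2 * Real.exp (-(ℓ ^ 2 / 2))) := by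
  have := hind.isProbabilityMeasure
  have hsg : ∀ i, HasSubgaussianMGF (Y i) ((‖c - -c‖₊ / 2) ^ 2) μ := fun i =>
    hasSubgaussianMGF_of_mem_Icc_of_integral_eq_zero (hm i)
      ((hb i).mono fun ω hω => abs_le.1 hω) (h0 i)
  have hn0 : (0 : ℝ) < n := by exact_mod_cast hn
  have hε : 0 ≤ c * ℓ * √n := by positivity
  have hcoef : ((∑ _i : Fin n, (‖c - -c‖₊ / 2) ^ 2 : ℝ≥0) : ℝ) = n * c ^ 2 := by
    simp only [Finset.sum_const, Finset.card_univ, Fintype.card_fin, nsmul_eq_mul, NNReal.coe_mul,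
      NNReal.coe_natCast, NNReal.coe_pow, NNReal.coe_div, coe_nnnorm, Real.norm_eq_abs,
      NNReal.coe_ofNat]
    rw [show c - -c = 2 * c by ring, abs_of_pos (by linarith)]
    ring
  have hexp : -(c * ℓ * √n) ^ 2 / (2 * (n * c ^ 2)) = -(ℓ ^ 2 / 2) := by
    rw [mul_pow, Real.sq_sqrt hn0.le]
    field_simp
  have h1 := HasSubgaussianMGF.measure_sum_ge_le_of_iIndepFun hind (s := Finset.univ)
    (fun i _ => hsg i) hε
  have h2 := HasSubgaussianMGF.measure_sum_ge_le_of_iIndepFun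
    (hind.comp (fun _ x => -x) (by fun_prop)) (s := Finset.univ)
    (fun i _ => (hsg i).neg) hε
  rw [hcoef, hexp] at h1 h2
  rw [← ENNReal.ofReal_toReal (measure_ne_top μ _)]
  apply ENNReal.ofReal_le_ofReal
  calc μ.real _ ≤ μ.real ({ω | c * ℓ * √n ≤ ∑ i, Y i ω} ∪
        {ω | c * ℓ * √n ≤ ∑ i, ((fun x => -x) ∘ Y i) ω}) := by
        apply measureReal_mono _ (by finiteness)
        intro ω hω
        simp only [Set.mem_ofPred_eq, Set.mem_union, Function.comp_apply,
          Finset.sum_neg_distrib] at hω ⊢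
        rcases lt_abs.1 hω with h | h
        · left; exact h.le
        · right; exact h.le
    _ ≤ _ := (measureReal_union_le _ _).trans (by linarith)

lemma indepFun_of_disjoint {ι A B : Type*} [Fintype A] [Fintype B] {F : ι → Ω → ℝ}
    (hF : iIndepFun F μ) (hm : ∀ i, AEMeasurable (F i) μ) (f : A → ι) (g : B → ι)
    (hfg : ∀ a b, f a ≠ g b) :
    IndepFun (fun ω a => F (f a) ω) (fun ω b => F (g b) ω) μ := by
  classical
  have hd : Disjoint (Finset.univ.image f) (Finset.univ.image g) := by
    rw [Finset.disjoint_left]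
    intro x hx hy
    obtain ⟨a, -, rfl⟩ := Finset.mem_image.1 hx
    obtain ⟨b, -, hb⟩ := Finset.mem_image.1 hy
    exact hfg a b hb.symm
  have h := hF.indepFun_finset₀ _ _ hd hm
  exact h.comp
    (φ := fun x a => x ⟨f a, Finset.mem_image_of_mem f (Finset.mem_univ a)⟩)
    (ψ := fun x b => x ⟨g b, Finset.mem_image_of_mem g (Finset.mem_univ b)⟩)
    (by fun_prop) (by fun_prop)

end Hoeffding

/-! ### The high-probability event -/

/-- The vectors to which the Johnson–Lindenstrauss bound is applied: the columns of the augmented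
design, and the vectors `[ξ; -wθ₀; w]` and `[0; -wθ₀; w]`. -/
def testVector {n p : ℕ} (w : ℝ) (X : Matrix (Fin n) (Fin p) ℝ) (ξ : Fin n → ℝ)
    (θ₀ : Fin p → ℝ) : Fin p ⊕ Bool → Fin n ⊕ (Fin p ⊕ Unit) → ℝ
  | Sum.inl j => fun l => augmentedDesign w X l j
  | Sum.inr true => Sum.elim ξ (Sum.elim (-(w • θ₀)) fun _ => w)
  | Sum.inr false => Sum.elim 0 (Sum.elim (-(w • θ₀)) fun _ => w)

/-- The event on which the design is nearly orthonormal, nearly orthogonal to the noise, and the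
projection nearly preserves the inner products of the test vectors. -/
structure IsGood {n p r : ℕ} (b bn w ℓ : ℝ) (X : Matrix (Fin n) (Fin p) ℝ) (ξ : Fin n → ℝ)
    (R : Matrix (Fin r) (Fin n ⊕ (Fin p ⊕ Unit)) ℝ) (θ₀ : Fin p → ℝ) : Prop where
  abs_X_le : ∀ i j, |X i j| ≤ b
  abs_ξ_le : ∀ i, |ξ i| ≤ bn
  gram : ∀ j k, |∑ i, (X i j * X i k - if j = k then 1 else 0)| ≤ (b ^ 2 + 1) * ℓ * √n
  cross : ∀ j, |∑ i, X i j * ξ i| ≤ b * bn * ℓ * √n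
  jl : ∀ q q', |jlForm (fun kl => R kl.1 kl.2) (testVector w X ξ θ₀ q) (testVector w X ξ θ₀ q')| ≤
    ℓ / √r * (√(testVector w X ξ θ₀ q ⬝ᵥ testVector w X ξ θ₀ q) *
      √(testVector w X ξ θ₀ q' ⬝ᵥ testVector w X ξ θ₀ q'))

section Model

variable {Ω : Type*} [MeasurableSpace Ω] {μ : Measure Ω} {n p r : ℕ} {D : Measure ℝ} {σ bn : ℝ}
  {X : Ω → Matrix (Fin n) (Fin p) ℝ} {ξ : Ω → Fin n → ℝ}
  {R : Ω → Matrix (Fin r) (Fin n ⊕ (Fin p ⊕ Unit)) ℝ}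

lemma IsModel.aemeasurable (hM : IsModel μ D σ bn X ξ R)
    (q : (Fin n × Fin p) ⊕ (Fin n ⊕ (Fin r × (Fin n ⊕ (Fin p ⊕ Unit))))) :
    AEMeasurable (Sum.elim (fun (ij : Fin n × Fin p) ω => X ω ij.1 ij.2)
      (Sum.elim (fun (i : Fin n) ω => ξ ω i)
        (fun (kl : Fin r × (Fin n ⊕ (Fin p ⊕ Unit))) ω => R ω kl.1 kl.2)) q) μ := by
  rcases q with ij | i | kl
  · exact (hM.law_X _ _).aemeasurable
  · exact (hM.law_ξ _).aemeasurable
  · exact (hM.law_R _ _).aemeasurable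

lemma IsModel.ae_abs_X_le (hM : IsModel μ D σ bn X ξ R) {b : ℝ} (hD : ∀ᵐ x ∂D, |x| ≤ b)
    (i : Fin n) (j : Fin p) : ∀ᵐ ω ∂μ, |X ω i j| ≤ b := by
  rw [← (hM.law_X i j).map_eq] at hD
  exact ae_of_ae_map (hM.law_X i j).aemeasurable hD

lemma ae_abs_le_truncatedGaussian (σ a : ℝ) : ∀ᵐ x ∂(truncatedGaussian σ a), |x| ≤ a := by
  filter_upwards [ae_cond_mem (μ := gaussianReal 0 (Real.toNNReal (σ ^ 2)))
    (measurableSet_Icc (a := -a) (b := a))] with x hx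
  exact abs_le.2 hx

lemma IsModel.ae_abs_ξ_le (hM : IsModel μ D σ bn X ξ R) (i : Fin n) : ∀ᵐ ω ∂μ, |ξ ω i| ≤ bn := by
  have h := ae_abs_le_truncatedGaussian σ bn
  rw [← (hM.law_ξ i).map_eq] at h
  exact ae_of_ae_map (hM.law_ξ i).aemeasurable h

lemma IsModel.integral_X (hM : IsModel μ D σ bn X ξ R) (h0 : ∫ x, x ∂D = 0)
    (i : Fin n) (j : Fin p) : ∫ ω, X ω i j ∂μ = 0 := by
  rw [← h0]
  exact (hM.law_X i j).integral_eq

lemma integral_sq_eq_one {D : Measure ℝ} [IsProbabilityMeasure D] (h0 : ∫ x, x ∂D = 0)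
    (h1 : ProbabilityTheory.variance id D = 1) : ∫ x, x ^ 2 ∂D = 1 := by
  rw [← h1, variance_of_integral_eq_zero aemeasurable_id (by simpa using h0)]
  rfl

lemma IsModel.integral_X_sq [IsProbabilityMeasure D] (hM : IsModel μ D σ bn X ξ R)
    (h0 : ∫ x, x ∂D = 0) (h1 : ProbabilityTheory.variance id D = 1)
    (i : Fin n) (j : Fin p) : ∫ ω, X ω i j * X ω i j ∂μ = 1 := by
  have := (hM.law_X i j).integral_comp (f := fun x : ℝ => x ^ 2) (by fun_prop)
  rw [integral_sq_eq_one h0 h1] at this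
  rw [← this]
  refine integral_congr_ae (ae_of_all _ fun ω => ?_)
  simp [sq]

/-- Rows are independent and the summands are bounded by b² + 1. They are centred by unit variance
on the diagonal, and by independence and zero mean off it. -/
lemma IsModel.measure_gram_le [IsProbabilityMeasure μ] [IsProbabilityMeasure D]
    (hM : IsModel μ D σ bn X ξ R) (hn : 0 < n)
    {b ℓ : ℝ} (hb : 0 ≤ b) (hℓ : 0 ≤ ℓ) (hD : ∀ᵐ x ∂D, |x| ≤ b) (h0 : ∫ x, x ∂D = 0)
    (h1 : ProbabilityTheory.variance id D = 1) (j k : Fin p) :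
    μ {ω | (b ^ 2 + 1) * ℓ * √n < |∑ i, (X ω i j * X ω i k - if j = k then 1 else 0)|}
      ≤ ENNReal.ofReal (2 * Real.exp (-(ℓ ^ 2 / 2))) := by
  have hXm : ∀ i j, AEMeasurable (fun ω => X ω i j) μ := fun i j => (hM.law_X i j).aemeasurable
  have hX : iIndepFun (fun (ij : Fin n × Fin p) ω => X ω ij.1 ij.2) μ :=
    hM.indep.precomp Sum.inl_injective
  have hrow := iIndepFun_curry hX fun ij => hXm _ _
  refine measure_lt_abs_sum_le hn
    (hrow.comp (fun _ x => x j * x k - if j = k then 1 else 0) (by fun_prop))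
    (fun i => ((hXm i j).mul (hXm i k)).sub_const _) (by positivity) hℓ (fun i => ?_) fun i => ?_
  · filter_upwards [hM.ae_abs_X_le hD i j, hM.ae_abs_X_le hD i k] with ω hj hk
    simp only [Function.comp_apply]
    refine (abs_sub _ _).trans (add_le_add ?_ ?_)
    · rw [abs_mul, sq]
      exact mul_le_mul hj hk (abs_nonneg _) hb
    · split_ifs <;> simp
  · simp only [Function.comp_apply]
    have hint : Integrable (fun ω => X ω i j * X ω i k) μ := by
      refine Integrable.of_bound ((hXm i j).mul (hXm i k)).aestronglyMeasurable (b * b) ?_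
      filter_upwards [hM.ae_abs_X_le hD i j, hM.ae_abs_X_le hD i k] with ω hj hk
      rw [Real.norm_eq_abs, abs_mul]
      exact mul_le_mul hj hk (abs_nonneg _) hb
    rw [integral_sub hint (integrable_const _)]
    by_cases hjk : j = k
    · subst hjk
      simp [hM.integral_X_sq h0 h1]
    · have hij : IndepFun (fun ω => X ω i j) (fun ω => X ω i k) μ :=
        hX.indepFun (i := (i, j)) (j := (i, k)) (by simpa using hjk)
      have := hij.integral_mul_eq_mul_integral (hXm i j).aestronglyMeasurable
        (hXm i k).aestronglyMeasurable
      simp only [Pi.mul_apply] at this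
      simp [hjk, this, hM.integral_X h0]

lemma IsModel.measure_cross_le [IsProbabilityMeasure μ]
    (hM : IsModel μ D σ bn X ξ R) (hn : 0 < n)
    {b ℓ : ℝ} (hb : 0 < b) (hbn : 0 < bn) (hℓ : 0 ≤ ℓ) (hD : ∀ᵐ x ∂D, |x| ≤ b)
    (h0 : ∫ x, x ∂D = 0) (j : Fin p) :
    μ {ω | b * bn * ℓ * √n < |∑ i, X ω i j * ξ ω i|}
      ≤ ENNReal.ofReal (2 * Real.exp (-(ℓ ^ 2 / 2))) := by
  have hXm : ∀ i j, AEMeasurable (fun ω => X ω i j) μ := fun i j => (hM.law_X i j).aemeasurable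
  have hξm : ∀ i, AEMeasurable (fun ω => ξ ω i) μ := fun i => (hM.law_ξ i).aemeasurable
  -- Groups the entry X i j with ξ i into the i-th block, so that the products over i are
  -- independent.
  let e : Fin n × Bool → (Fin n × Fin p) ⊕ (Fin n ⊕ (Fin r × (Fin n ⊕ (Fin p ⊕ Unit)))) :=
    fun q => if q.2 then Sum.inl (q.1, j) else Sum.inr (Sum.inl q.1)
  have he : Function.Injective e := by
    rintro ⟨i, x⟩ ⟨i', x'⟩ h
    rcases x <;> rcases x' <;> simp_all [e]
  have hrow := iIndepFun_curry (hM.indep.precomp he) fun q => hM.aemeasurable _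
  have hprod := hrow.comp (fun _ x => x true * x false) (by fun_prop)
  refine measure_lt_abs_sum_le hn (Y := fun i ω => X ω i j * ξ ω i) hprod
    (fun i => (hXm i j).mul (hξm i)) (mul_pos hb hbn) hℓ (fun i => ?_) fun i => ?_
  · filter_upwards [hM.ae_abs_X_le hD i j, hM.ae_abs_ξ_le i] with ω hj hk
    rw [abs_mul]
    exact mul_le_mul hj hk (abs_nonneg _) hb.le
  · have hij : IndepFun (fun ω => X ω i j) (fun ω => ξ ω i) μ :=
      hM.indep.indepFun (i := Sum.inl (i, j)) (j := Sum.inr (Sum.inl i)) (by simp)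
    have := hij.integral_mul_eq_mul_integral (hXm i j).aestronglyMeasurable
      (hξm i).aestronglyMeasurable
    simp only [Pi.mul_apply] at this
    simp [this, hM.integral_X h0]

lemma measurable_testVector (w : ℝ) (θ₀ : Fin p → ℝ) (q : Fin p ⊕ Bool) :
    Measurable fun z : (Fin n × Fin p) ⊕ Fin n → ℝ =>
      testVector w (Matrix.of fun i j => z (Sum.inl (i, j))) (fun i => z (Sum.inr i)) θ₀ q := by
  refine measurable_pi_lambda _ fun l => ?_
  rcases q with j | _ | _ <;> rcases l with i | i | i <;>
    simp only [testVector, augmentedDesign, Matrix.fromRows_apply_inl, Matrix.fromRows_apply_inr,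
      Matrix.of_apply, Sum.elim_inl, Sum.elim_inr, Pi.zero_apply] <;> fun_prop

/-- The test vectors are functions of (X, ξ), which is independent of R. The condition ℓ ≤ √r keeps
the relative deviation ℓ / √r at most 1. -/
lemma IsModel.measure_jl_le [IsProbabilityMeasure μ] (hM : IsModel μ D σ bn X ξ R) (hr : 0 < r)
    (w : ℝ) (θ₀ : Fin p → ℝ) {ℓ : ℝ} (hℓ : 0 ≤ ℓ) (hℓr : ℓ ≤ √r) (q q' : Fin p ⊕ Bool) :
    μ {ω | ℓ / √r * (√(testVector w (X ω) (ξ ω) θ₀ q ⬝ᵥ testVector w (X ω) (ξ ω) θ₀ q) *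
      √(testVector w (X ω) (ξ ω) θ₀ q' ⬝ᵥ testVector w (X ω) (ξ ω) θ₀ q')) <
      |jlForm (fun kl => R ω kl.1 kl.2) (testVector w (X ω) (ξ ω) θ₀ q)
        (testVector w (X ω) (ξ ω) θ₀ q')|}
      ≤ ENNReal.ofReal (4 * Real.exp (-(ℓ ^ 2 / 16))) := by
  have hr0 : (0 : ℝ) < r := by exact_mod_cast hr
  have hs : 0 < √(r : ℝ) := Real.sqrt_pos.2 hr0
  have hR : HasLaw (fun ω (kl : Fin r × (Fin n ⊕ (Fin p ⊕ Unit))) => R ω kl.1 kl.2)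
      (Measure.pi fun _ => gaussianReal 0 (1 / (r : ℝ≥0))) μ :=
    (hM.indep.precomp (g := fun kl => Sum.inr (Sum.inr kl))
      (Sum.inr_injective.comp Sum.inr_injective)).hasLaw_pi fun kl => hM.law_R _ _
  have hind := indepFun_of_disjoint hM.indep hM.aemeasurable
    (A := (Fin n × Fin p) ⊕ Fin n) (Sum.map id Sum.inl)
    (B := Fin r × (Fin n ⊕ (Fin p ⊕ Unit))) (fun kl => Sum.inr (Sum.inr kl))
    (by rintro (a | a) kl <;> simp)
  have := measure_lt_abs_jlForm_comp_le hr
    (aemeasurable_pi_lambda _ fun a => hM.aemeasurable _) hR hind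
    (measurable_testVector w θ₀ q) (measurable_testVector w θ₀ q') (t := ℓ / √r)
    (by positivity) ((div_le_one hs).2 hℓr)
  rw [div_pow, Real.sq_sqrt hr0.le, mul_div_cancel₀ _ hr0.ne'] at this
  exact this

/-- Union bound over p² Gram entries, p noise correlations and (p + 2)² pairs of test vectors; the
entrywise bounds on X and ξ hold almost surely and cost nothing. -/
theorem IsModel.measure_not_isGood_le [IsProbabilityMeasure μ] [IsProbabilityMeasure D]
    (hM : IsModel μ D σ bn X ξ R) (hn : 0 < n) (hr : 0 < r)
    {b ℓ : ℝ} (hb : 0 < b) (hbn : 0 < bn) (hℓ : 0 ≤ ℓ) (hℓr : ℓ ≤ √r)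
    (hD : ∀ᵐ x ∂D, |x| ≤ b) (h0 : ∫ x, x ∂D = 0) (h1 : ProbabilityTheory.variance id D = 1)
    (w : ℝ) (θ₀ : Fin p → ℝ) :
    μ {ω | ¬ IsGood b bn w ℓ (X ω) (ξ ω) (R ω) θ₀} ≤
      ENNReal.ofReal ((p * p + p + (p + 2) * (p + 2)) * (4 * Real.exp (-(ℓ ^ 2 / 16)))) := by
  set ε : ℝ := 4 * Real.exp (-(ℓ ^ 2 / 16)) with hε
  have hεle : ENNReal.ofReal (2 * Real.exp (-(ℓ ^ 2 / 2))) ≤ ENNReal.ofReal ε := by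
    apply ENNReal.ofReal_le_ofReal
    have : Real.exp (-(ℓ ^ 2 / 2)) ≤ Real.exp (-(ℓ ^ 2 / 16)) := by
      apply Real.exp_le_exp.2; nlinarith [sq_nonneg ℓ]
    have := Real.exp_pos (-(ℓ ^ 2 / 16))
    linarith
  set S₀ : Set Ω := {ω | ¬ ((∀ i j, |X ω i j| ≤ b) ∧ ∀ i, |ξ ω i| ≤ bn)}
  set S₁ : Fin p × Fin p → Set Ω := fun jk => {ω | (b ^ 2 + 1) * ℓ * √n <
    |∑ i, (X ω i jk.1 * X ω i jk.2 - if jk.1 = jk.2 then 1 else 0)|}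
  set S₂ : Fin p → Set Ω := fun j => {ω | b * bn * ℓ * √n < |∑ i, X ω i j * ξ ω i|}
  set S₃ : (Fin p ⊕ Bool) × (Fin p ⊕ Bool) → Set Ω := fun qq =>
    {ω | ℓ / √r * (√(testVector w (X ω) (ξ ω) θ₀ qq.1 ⬝ᵥ testVector w (X ω) (ξ ω) θ₀ qq.1) *
      √(testVector w (X ω) (ξ ω) θ₀ qq.2 ⬝ᵥ testVector w (X ω) (ξ ω) θ₀ qq.2)) <
      |jlForm (fun kl => R ω kl.1 kl.2) (testVector w (X ω) (ξ ω) θ₀ qq.1)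
        (testVector w (X ω) (ξ ω) θ₀ qq.2)|}
  have hS₀ : μ S₀ = 0 := by
    have h2 : ∀ᵐ ω ∂μ, ∀ i j, |X ω i j| ≤ b :=
      ae_all_iff.2 fun i => ae_all_iff.2 fun j => hM.ae_abs_X_le hD i j
    have h3 : ∀ᵐ ω ∂μ, ∀ i, |ξ ω i| ≤ bn := ae_all_iff.2 fun i => hM.ae_abs_ξ_le i
    exact ae_iff.1 (h2.and h3)
  have hsub : {ω | ¬ IsGood b bn w ℓ (X ω) (ξ ω) (R ω) θ₀} ⊆
      S₀ ∪ ((⋃ jk, S₁ jk) ∪ ((⋃ j, S₂ j) ∪ ⋃ qq, S₃ qq)) := by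
    intro ω hω
    by_contra hcon
    simp only [Set.mem_union, Set.mem_iUnion, not_or, not_exists] at hcon
    obtain ⟨c0, c1, c2, c3⟩ := hcon
    have c0' := not_not.1 c0
    exact hω ⟨c0'.1, c0'.2, fun j k => not_lt.1 (c1 (j, k)), fun j => not_lt.1 (c2 j),
      fun q q' => not_lt.1 (c3 (q, q'))⟩
  have hunion : ∀ {A : Type} [Fintype A] (S : A → Set Ω) (_ : ∀ a, μ (S a) ≤ ENNReal.ofReal ε),
      μ (⋃ a, S a) ≤ ENNReal.ofReal (Fintype.card A * ε) := by
    intro A _ S hS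
    refine (measure_iUnion_fintype_le μ S).trans ((Finset.sum_le_sum fun a _ => hS a).trans ?_)
    rw [Finset.sum_const, Finset.card_univ, nsmul_eq_mul, ENNReal.ofReal_mul (p := (Fintype.card A : ℝ)) (by positivity),
      ENNReal.ofReal_natCast]
  have u1 := hunion S₁ fun jk =>
    (hM.measure_gram_le hn hb.le hℓ hD h0 h1 jk.1 jk.2).trans hεle
  have u2 := hunion S₂ fun j => (hM.measure_cross_le hn hb hbn hℓ hD h0 j).trans hεle
  have u3 := hunion S₃ fun qq => hM.measure_jl_le hr w θ₀ hℓ hℓr qq.1 qq.2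
  have hε0 : 0 ≤ ε := by positivity
  calc _ ≤ _ := measure_mono hsub
    _ ≤ μ S₀ + (μ (⋃ jk, S₁ jk) + (μ (⋃ j, S₂ j) + μ (⋃ qq, S₃ qq))) := by
      refine (measure_union_le _ _).trans (add_le_add le_rfl ?_)
      exact (measure_union_le _ _).trans (add_le_add le_rfl (measure_union_le _ _))
    _ ≤ 0 + (_ + (_ + _)) := add_le_add hS₀.le (add_le_add u1 (add_le_add u2 u3))
    _ = _ := by
      rw [zero_add, ← ENNReal.ofReal_add (by positivity) (by positivity),
        ← ENNReal.ofReal_add (by positivity) (by positivity)]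
      congr 1
      simp only [Fintype.card_prod, Fintype.card_fin, Fintype.card_sum, Fintype.card_bool]
      push_cast
      ring

end Model

/-! ### The deterministic part -/

/-- With s = ‖h‖₁ and T = ‖h‖₂², an entrywise error e costs at most e s² ≤ e p T ≤ T/2 by
Cauchy–Schwarz, so the quadratic form is at least T/2. The hypothesis then gives T ≤ 4(N + λ)s, and
s² ≤ p T turns this into a bound on s. There is no requirement that λ dominate N. -/
lemma sum_abs_le_of_quadratic_le {p : ℕ} {h g : Fin p → ℝ} {G : Fin p → Fin p → ℝ}
    {c e N lam : ℝ} (hc : 1 ≤ c) (hpe : p * e ≤ 1 / 2)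
    (hG : ∀ j k, |G j k - if j = k then c else 0| ≤ e) (hg : ∀ j, |g j| ≤ N)
    (hq : 1 / 2 * ∑ j, ∑ k, h j * h k * G j k + ∑ j, h j * g j ≤ lam * ∑ j, |h j|)
    (hN : 0 ≤ N) (hlam : 0 ≤ lam) :
    ∑ j, |h j| ≤ 4 * p * (N + lam) := by
  set s := ∑ j, |h j| with hs
  have hs0 : 0 ≤ s := Finset.sum_nonneg fun j _ => abs_nonneg _
  set T := ∑ j, h j ^ 2 with hT
  have hT0 : 0 ≤ T := Finset.sum_nonneg fun j _ => sq_nonneg _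
  have hcs : s ^ 2 ≤ p * T := by
    have := sq_sum_le_card_mul_sum_sq (s := (Finset.univ : Finset (Fin p))) (f := fun j => |h j|)
    simpa [hs, hT, sq_abs] using this
  have hquad : c * T - e * s ^ 2 ≤ ∑ j, ∑ k, h j * h k * G j k := by
    have h1 : c * T = ∑ j, ∑ k, h j * h k * (if j = k then c else 0) := by
      rw [hT, Finset.mul_sum]
      refine Finset.sum_congr rfl fun j _ => ?_
      simp only [mul_ite, mul_zero, Finset.sum_ite_eq, Finset.mem_univ, if_true]
      ring
    have h2 : e * s ^ 2 = ∑ j, ∑ k, |h j| * |h k| * e := by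
      rw [sq, hs, Finset.sum_mul_sum, Finset.mul_sum]
      refine Finset.sum_congr rfl fun j _ => ?_
      rw [Finset.mul_sum]
      exact Finset.sum_congr rfl fun k _ => by ring
    rw [h1, h2, ← Finset.sum_sub_distrib]
    refine Finset.sum_le_sum fun j _ => ?_
    rw [← Finset.sum_sub_distrib]
    refine Finset.sum_le_sum fun k _ => ?_
    have h3 : |h j * h k * (G j k - if j = k then c else 0)| ≤ |h j| * |h k| * e := by
      rw [abs_mul, abs_mul]
      exact mul_le_mul_of_nonneg_left (hG j k) (by positivity)
    have := (abs_le.1 h3).1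
    rw [mul_sub] at this
    linarith
  have hlin : -(N * s) ≤ ∑ j, h j * g j := by
    rw [hs, Finset.mul_sum, ← Finset.sum_neg_distrib]
    refine Finset.sum_le_sum fun j _ => ?_
    have h3 : |h j * g j| ≤ N * |h j| := by
      rw [abs_mul, mul_comm]
      exact mul_le_mul_of_nonneg_right (hg j) (abs_nonneg _)
    exact (abs_le.1 h3).1
  rcases Nat.eq_zero_or_pos p with hp | hp
  · subst hp
    simp [hs]
  have hp0 : (0 : ℝ) < p := by exact_mod_cast hp
  -- The sign of e is not assumed, and multiplying s² ≤ p T by e needs e > 0.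
  have hes : e * s ^ 2 ≤ T / 2 := by
    rcases le_or_gt e 0 with he | he
    · nlinarith [sq_nonneg s]
    · nlinarith
  have hTs : T ≤ 4 * (N + lam) * s := by nlinarith
  rcases hs0.eq_or_lt with h0 | h0
  · rw [← h0]; positivity
  · have : s * s ≤ (4 * p * (N + lam)) * s := by nlinarith
    exact le_of_mul_le_mul_right this h0

/-! ### Algebra of the private Lasso residual and of the bias -/

section

variable {n p r : ℕ}

lemma dotProduct_mulVec_eq_jlForm (R : Matrix (Fin r) (Fin n ⊕ (Fin p ⊕ Unit)) ℝ)
    (u v : Fin n ⊕ (Fin p ⊕ Unit) → ℝ) :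
    u ⬝ᵥ ((R.transpose * R - 1).mulVec v) = jlForm (fun kl => R kl.1 kl.2) u v := by
  rw [Matrix.sub_mulVec, dotProduct_sub, Matrix.one_mulVec, ← Matrix.mulVec_mulVec,
    Matrix.dotProduct_mulVec, Matrix.vecMul_transpose]
  simp only [jlForm, dotProduct, Matrix.mulVec]

lemma jlForm_add_right {L : Type*} [Fintype L] (R : Fin r × L → ℝ) (u v v' : L → ℝ) :
    jlForm R u (v + v') = jlForm R u v + jlForm R u v' := by
  simp only [jlForm, Pi.add_apply, mul_add, Finset.sum_add_distrib, dotProduct_add]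
  ring

lemma jlForm_sum_right {L ι : Type*} [Fintype L] (S : Finset ι) (R : Fin r × L → ℝ) (u : L → ℝ)
    (c : ι → ℝ) (v : ι → L → ℝ) :
    jlForm R u (fun l => ∑ k ∈ S, c k * v k l) = ∑ k ∈ S, c k * jlForm R u (v k) := by
  classical
  induction S using Finset.induction_on with
  | empty => simp [jlForm, dotProduct]
  | insert a S ha ih =>
    have h1 : (fun l => ∑ k ∈ insert a S, c k * v k l)
        = (c a • v a) + fun l => ∑ k ∈ S, c k * v k l := by
      ext l; simp [Finset.sum_insert ha]
    have h2 := jlForm_smul_smul R u (v a) 1 (c a)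
    rw [one_smul, one_mul] at h2
    rw [h1, jlForm_add_right, ih, Finset.sum_insert ha, h2]

variable (w : ℝ) (X : Matrix (Fin n) (Fin p) ℝ) (ξ : Fin n → ℝ) (θ₀ : Fin p → ℝ)

lemma augmentedDesign_dotProduct (j k : Fin p) :
    (fun l => augmentedDesign w X l j) ⬝ᵥ (fun l => augmentedDesign w X l k)
      = ∑ i, X i j * X i k + if j = k then w ^ 2 else 0 := by
  simp only [dotProduct, Fintype.sum_sum_type, augmentedDesign, Matrix.fromRows_apply_inl,
    Matrix.fromRows_apply_inr, Matrix.smul_apply, Matrix.one_apply, Matrix.zero_apply, smul_eq_mul]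
  congr 1
  by_cases hjk : j = k
  · subst hjk
    simp [sq]
  · simp [hjk]
    exact fun h => (hjk h.symm).elim

lemma augmentedDesign_dotProduct_elim (j : Fin p) (f : Fin n → ℝ) :
    (fun l => augmentedDesign w X l j) ⬝ᵥ (Sum.elim f (Sum.elim (-(w • θ₀)) fun _ => w))
      = ∑ i, X i j * f i - w ^ 2 * θ₀ j := by
  simp only [dotProduct, Fintype.sum_sum_type, augmentedDesign, Matrix.fromRows_apply_inl,
    Matrix.fromRows_apply_inr, Matrix.smul_apply, Matrix.one_apply, Matrix.zero_apply, smul_eq_mul,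
    Sum.elim_inl, Sum.elim_inr, Pi.neg_apply, Pi.smul_apply]
  simp
  ring

lemma elim_dotProduct_self (f : Fin n → ℝ) (hθ₀ : ∑ j, θ₀ j ^ 2 = 1) :
    (Sum.elim f (Sum.elim (-(w • θ₀)) fun _ : Unit => w)) ⬝ᵥ
      (Sum.elim f (Sum.elim (-(w • θ₀)) fun _ : Unit => w)) = ∑ i, f i ^ 2 + 2 * w ^ 2 := by
  simp only [dotProduct, Fintype.sum_sum_type, Sum.elim_inl, Sum.elim_inr, Pi.neg_apply,
    Pi.smul_apply, smul_eq_mul, Finset.univ_unique, Finset.sum_const, Finset.card_singleton]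
  have : ∀ j, -(w * θ₀ j) * -(w * θ₀ j) = w ^ 2 * θ₀ j ^ 2 := fun j => by ring
  simp only [this, ← Finset.mul_sum, hθ₀, ← sq]
  simp
  ring

/-- The augmented response [Xθ₀ + ξ; 0; w] equals Aθ₀ + [ξ; -wθ₀; w] for the augmented design A: the
privacy block of Aθ₀ is wθ₀ and must be cancelled. The private problem is thus a linear model with
this second vector as noise. -/
lemma privateX_mulVec_sub_privateY (R : Matrix (Fin r) (Fin n ⊕ (Fin p ⊕ Unit)) ℝ)
    (θ : Fin p → ℝ) (k : Fin r) :
    (privateX w X (X.mulVec θ₀ + ξ) R).mulVec θ k - privateY w X (X.mulVec θ₀ + ξ) R k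
      = -(∑ j, (θ₀ - θ) j * (∑ l, R k l * augmentedDesign w X l j)
        + ∑ l, R k l * testVector w X ξ θ₀ (Sum.inr true) l) := by
  have hX : ∀ j, privateX w X (X.mulVec θ₀ + ξ) R k j = ∑ l, R k l * augmentedDesign w X l j := by
    intro j
    simp only [privateX, privateData, Matrix.toCols₁_apply, Matrix.mul_apply]
    refine Finset.sum_congr rfl fun l _ => ?_
    rcases l with i | i | i <;> simp [augmentedDesign, Matrix.one_apply]
  have hY : privateY w X (X.mulVec θ₀ + ξ) R k
      = ∑ j, θ₀ j * (∑ l, R k l * augmentedDesign w X l j)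
        + ∑ l, R k l * testVector w X ξ θ₀ (Sum.inr true) l := by
    have h1 : ∑ j, θ₀ j * (∑ l, R k l * augmentedDesign w X l j)
        = ∑ l, R k l * (augmentedDesign w X).mulVec θ₀ l := by
      simp only [Finset.mul_sum, Matrix.mulVec, dotProduct]
      rw [Finset.sum_comm]
      exact Finset.sum_congr rfl fun l _ => Finset.sum_congr rfl fun j _ => by ring
    rw [h1, ← Finset.sum_add_distrib]
    simp only [privateY, privateData, Matrix.mul_apply]
    refine Finset.sum_congr rfl fun l _ => ?_
    rw [← mul_add]
    congr 1
    rcases l with i | i | i <;>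
      simp [augmentedDesign, testVector, Matrix.fromRows_mulVec, Matrix.smul_mulVec]
  rw [hY]
  simp only [Matrix.mulVec, dotProduct, hX, Pi.sub_apply, sub_mul, Finset.sum_sub_distrib]
  simp only [mul_comm (∑ l, R k l * augmentedDesign w X l _)]
  ring

/-- The basic inequality for the private Lasso. -/
lemma IsPrivateLasso.basic_inequality (hn : 0 < n) {lam : ℝ} (hlam : 0 ≤ lam)
    {R : Matrix (Fin r) (Fin n ⊕ (Fin p ⊕ Unit)) ℝ} {θ : Fin p → ℝ}
    (h : IsPrivateLasso lam w X (X.mulVec θ₀ + ξ) R θ) :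
    1 / 2 * ∑ j, ∑ k, (θ₀ - θ) j * (θ₀ - θ) k * (1 / n *
        ∑ i, (∑ l, R i l * augmentedDesign w X l j) * (∑ l, R i l * augmentedDesign w X l k))
      + ∑ j, (θ₀ - θ) j * (1 / n * ∑ i, (∑ l, R i l * augmentedDesign w X l j) *
          (∑ l, R i l * testVector w X ξ θ₀ (Sum.inr true) l))
      ≤ lam * ∑ j, |(θ₀ - θ) j| := by
  have h1 := h θ₀
  simp only [lassoObjective, privateX_mulVec_sub_privateY, sub_self, Pi.zero_apply, zero_mul,
    Finset.sum_const_zero, zero_add, neg_sq] at h1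
  set a : Fin r → Fin p → ℝ := fun i j => ∑ l, R i l * augmentedDesign w X l j with ha
  set c : Fin r → ℝ := fun i => ∑ l, R i l * testVector w X ξ θ₀ (Sum.inr true) l with hc
  set d := θ₀ - θ with hd
  have hn0 : (0 : ℝ) < n := by exact_mod_cast hn
  have e1 : ∑ j, ∑ k, d j * d k * (1 / (n : ℝ) * ∑ i, a i j * a i k)
      = 1 / n * ∑ i, (∑ j, d j * a i j) ^ 2 := by
    have hsq : ∀ i, (∑ j, d j * a i j) ^ 2 = ∑ j, ∑ k, d j * a i j * (d k * a i k) := fun i => by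
      rw [sq, Finset.sum_mul_sum]
    simp only [hsq, Finset.mul_sum]
    rw [Finset.sum_comm (s := (Finset.univ : Finset (Fin r)))]
    refine Finset.sum_congr rfl fun j _ => ?_
    rw [Finset.sum_comm]
    exact Finset.sum_congr rfl fun i _ => Finset.sum_congr rfl fun k _ => by ring
  have e2 : ∑ j, d j * (1 / (n : ℝ) * ∑ i, a i j * c i)
      = 1 / n * ∑ i, (∑ j, d j * a i j) * c i := by
    simp only [Finset.sum_mul, Finset.mul_sum]
    rw [Finset.sum_comm]
    exact Finset.sum_congr rfl fun j _ => Finset.sum_congr rfl fun i _ => by ring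
  have e3 : ∑ i, (∑ j, d j * a i j + c i) ^ 2
      = ∑ i, (∑ j, d j * a i j) ^ 2 + 2 * ∑ i, (∑ j, d j * a i j) * c i + ∑ i, c i ^ 2 := by
    rw [Finset.mul_sum, ← Finset.sum_add_distrib, ← Finset.sum_add_distrib]
    exact Finset.sum_congr rfl fun i _ => by ring
  -- Plain triangle inequality, without splitting by the support of θ₀: restricted eigenvalues are
  -- not needed later.
  have e4 : ∑ j, |θ₀ j| - ∑ j, |θ j| ≤ ∑ j, |d j| := by
    rw [← Finset.sum_sub_distrib]
    exact Finset.sum_le_sum fun j _ => abs_sub_abs_le_abs_sub _ _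
  have e5 : lam * (∑ j, |θ₀ j| - ∑ j, |θ j|) ≤ lam * ∑ j, |d j| :=
    mul_le_mul_of_nonneg_left e4 hlam
  rw [e1, e2]
  change 1 / (2 * (n : ℝ)) * ∑ i, (∑ j, d j * a i j + c i) ^ 2 + _ ≤ 1 / (2 * n) * ∑ i, c i ^ 2 + _
    at h1
  rw [e3] at h1
  have e6 : 1 / (2 * (n : ℝ)) = 1 / 2 * (1 / n) := by field_simp
  rw [e6] at h1
  linarith

/-- The vector [X(θ₀ - θ); -wθ; w] is Aθ₀ - Aθ plus [0; -wθ₀; w], so everything random in θ enters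
linearly through θ₀ - θ. The noise ξ appears only as an argument of `testVector`; the vectors used
here do not depend on it. -/
lemma bias_apply (R : Matrix (Fin r) (Fin n ⊕ (Fin p ⊕ Unit)) ℝ) (hn : 0 < n) (θ : Fin p → ℝ)
    (j : Fin p) :
    bias w X R θ₀ θ j = ∑ k, (θ₀ - θ) k * (1 / n *
        (∑ i, (X i j * X i k - if j = k then 1 else 0) + jlForm (fun kl => R kl.1 kl.2)
          (testVector w X ξ θ₀ (Sum.inl j)) (testVector w X ξ θ₀ (Sum.inl k))))
      + 1 / n * jlForm (fun kl => R kl.1 kl.2) (testVector w X ξ θ₀ (Sum.inl j))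
          (testVector w X ξ θ₀ (Sum.inr false)) := by
  have hn0 : (n : ℝ) ≠ 0 := by exact_mod_cast hn.ne'
  set d := θ₀ - θ with hd
  have hvec : (Sum.elim (X.mulVec d) (Sum.elim (-(w • θ)) (fun _ : Unit => w)))
      = (fun l => ∑ k, d k * testVector w X ξ θ₀ (Sum.inl k) l)
        + testVector w X ξ θ₀ (Sum.inr false) := by
    ext l
    rcases l with i | i | i
    · simp [testVector, augmentedDesign, Matrix.mulVec, dotProduct, mul_comm]
    · simp [testVector, augmentedDesign, Matrix.one_apply, hd]
      ring
    · simp [testVector, augmentedDesign]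
  have hT : Matrix.mulVec (augmentedDesign w X).transpose
      (Matrix.mulVec (R.transpose * R - 1)
        (Sum.elim (X.mulVec d) (Sum.elim (-(w • θ)) (fun _ : Unit => w)))) j
      = jlForm (fun kl => R kl.1 kl.2) (testVector w X ξ θ₀ (Sum.inl j))
        (Sum.elim (X.mulVec d) (Sum.elim (-(w • θ)) (fun _ : Unit => w))) :=
    dotProduct_mulVec_eq_jlForm R _ _
  have hE : Matrix.mulVec ((1 / (n : ℝ)) • (X.transpose * X) - (1 : Matrix (Fin p) (Fin p) ℝ)) d j
      = ∑ k, d k * (1 / n * ∑ i, (X i j * X i k - if j = k then 1 else 0)) := by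
    simp only [Matrix.mulVec, dotProduct, Matrix.sub_apply, Matrix.smul_apply, Matrix.mul_apply,
      Matrix.transpose_apply, Matrix.one_apply, smul_eq_mul, Finset.sum_sub_distrib,
      Finset.sum_const, Finset.card_univ, Fintype.card_fin, nsmul_eq_mul]
    refine Finset.sum_congr rfl fun k _ => ?_
    rw [mul_sub, ← mul_assoc (1 / (n : ℝ)) (n : ℝ), one_div_mul_cancel hn0]
    ring
  rw [bias, ← hd, Pi.add_apply, Pi.smul_apply, hT, hE, hvec, jlForm_add_right, jlForm_sum_right,
    smul_eq_mul, mul_add, ← add_assoc, Finset.mul_sum, ← Finset.sum_add_distrib]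
  congr 1
  exact Finset.sum_congr rfl fun k _ => by ring

/-- On the good event the bias of the private Lasso is small. -/
theorem IsGood.norm_bias_le {w : ℝ} {X : Matrix (Fin n) (Fin p) ℝ} {ξ : Fin n → ℝ}
    {θ₀ : Fin p → ℝ} {R : Matrix (Fin r) (Fin n ⊕ (Fin p ⊕ Unit)) ℝ} {b bn ℓ lam e N : ℝ}
    (hgood : IsGood b bn w ℓ X ξ R θ₀) (hn : 0 < n)
    (hw0 : 0 ≤ w) (hw : w ^ 2 ≤ n) (hb : 0 ≤ b) (hbn : 0 ≤ bn) (hℓ : 0 ≤ ℓ) (hlam : 0 ≤ lam)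
    (hθ₀ : ∑ j, θ₀ j ^ 2 = 1)
    (he : (b ^ 2 + 1) * (ℓ / √n) + (b ^ 2 + 1) * (ℓ / √r) ≤ e) (hpe : p * e ≤ 1 / 2)
    (hN : b * bn * (ℓ / √n) + w ^ 2 / n + ℓ / √r * (√(b ^ 2 + 1) * √(bn ^ 2 + 2)) ≤ N)
    {θ : Fin p → ℝ} (hθ : IsPrivateLasso lam w X (X.mulVec θ₀ + ξ) R θ) :
    ‖bias w X R θ₀ θ‖ ≤
      4 * p * e * (N + lam) + ℓ / √r * (√(b ^ 2 + 1) * (√2 * (w / √n))) := by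
  have hn0 : (0 : ℝ) < n := by exact_mod_cast hn
  have hsn : 0 < √(n : ℝ) := Real.sqrt_pos.2 hn0
  have hsn2 : √(n : ℝ) * √(n : ℝ) = n := Real.mul_self_sqrt hn0.le
  set J := jlForm (r := r) (fun kl => R kl.1 kl.2) with hJ
  set tv := testVector w X ξ θ₀ with htv
  -- The norms of the augmented columns stay of order √n because w² ≤ n.
  have hA : ∀ j, √(tv (Sum.inl j) ⬝ᵥ tv (Sum.inl j)) ≤ √n * √(b ^ 2 + 1) := by
    intro j
    rw [← Real.sqrt_mul hn0.le]
    apply Real.sqrt_le_sqrt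
    have h1 := augmentedDesign_dotProduct w X j j
    rw [if_pos rfl] at h1
    have h2 : ∑ i, X i j * X i j ≤ n * b ^ 2 := by
      calc _ ≤ ∑ _i : Fin n, b ^ 2 := Finset.sum_le_sum fun i _ => by
            rw [← sq]; exact sq_le_sq' (abs_le.1 (hgood.abs_X_le i j)).1
              (abs_le.1 (hgood.abs_X_le i j)).2
        _ = _ := by simp
    change (fun l => augmentedDesign w X l j) ⬝ᵥ (fun l => augmentedDesign w X l j) ≤ _
    rw [h1]
    linarith
  have hν : √(tv (Sum.inr true) ⬝ᵥ tv (Sum.inr true)) ≤ √n * √(bn ^ 2 + 2) := by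
    rw [← Real.sqrt_mul hn0.le]
    apply Real.sqrt_le_sqrt
    have h2 : ∑ i, ξ i ^ 2 ≤ n * bn ^ 2 := by
      calc _ ≤ ∑ _i : Fin n, bn ^ 2 := Finset.sum_le_sum fun i _ => by
            exact sq_le_sq' (abs_le.1 (hgood.abs_ξ_le i)).1 (abs_le.1 (hgood.abs_ξ_le i)).2
        _ = _ := by simp
    simp only [htv, testVector]
    rw [elim_dotProduct_self w θ₀ ξ hθ₀]
    linarith
  have hv : √(tv (Sum.inr false) ⬝ᵥ tv (Sum.inr false)) = √2 * w := by
    simp only [htv, testVector]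
    rw [elim_dotProduct_self w θ₀ 0 hθ₀]
    simp [Real.sqrt_sq hw0]
  have hℓr : 0 ≤ ℓ / √r := by positivity
  have hM : ∀ j k, |1 / (n : ℝ) * J (tv (Sum.inl j)) (tv (Sum.inl k))|
      ≤ (b ^ 2 + 1) * (ℓ / √r) := by
    intro j k
    rw [abs_mul, abs_of_pos (by positivity : (0 : ℝ) < 1 / n)]
    calc _ ≤ 1 / (n : ℝ) * (ℓ / √r * ((√n * √(b ^ 2 + 1)) * (√n * √(b ^ 2 + 1)))) := by
          gcongr
          refine (hgood.jl _ _).trans ?_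
          gcongr
          · exact hA j
          · exact hA k
      _ = 1 / (n : ℝ) * (√n * √n) * (ℓ / √r) * (√(b ^ 2 + 1) * √(b ^ 2 + 1)) := by ring
      _ = _ := by
          rw [hsn2, Real.mul_self_sqrt (by positivity), one_div_mul_cancel hn0.ne']; ring
  have hsq : ∀ x : ℝ, 1 / (n : ℝ) * (x * √n) = x / √n := by
    intro x
    rw [eq_div_iff hsn.ne', mul_assoc, mul_assoc, hsn2]
    field_simp
  have hE : ∀ j k, |1 / (n : ℝ) * ∑ i, (X i j * X i k - if j = k then 1 else 0)|
      ≤ (b ^ 2 + 1) * (ℓ / √n) := by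
    intro j k
    rw [abs_mul, abs_of_pos (by positivity : (0 : ℝ) < 1 / n)]
    calc _ ≤ 1 / (n : ℝ) * ((b ^ 2 + 1) * ℓ * √n) := by gcongr; exact hgood.gram j k
      _ = _ := by rw [hsq]; ring
  have hEM : ∀ j k, |1 / (n : ℝ) * (∑ i, (X i j * X i k - if j = k then 1 else 0) +
      J (tv (Sum.inl j)) (tv (Sum.inl k)))| ≤ e := by
    intro j k
    rw [mul_add]
    exact (abs_add_le _ _).trans ((add_le_add (hE j k) (hM j k)).trans he)
  have hθle : ∀ j, |θ₀ j| ≤ 1 := by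
    intro j
    rw [← sq_le_one_iff_abs_le_one, ← hθ₀]
    exact Finset.single_le_sum (f := fun j => θ₀ j ^ 2) (fun j _ => sq_nonneg _)
      (Finset.mem_univ j)
  have hJeq : ∀ u v, ∑ i, (∑ l, R i l * u l) * (∑ l, R i l * v l) = J u v + u ⬝ᵥ v := by
    intro u v
    simp only [hJ, jlForm, sub_add_cancel]
  have hnoise : ∀ j, |1 / (n : ℝ) * ∑ i, (∑ l, R i l * augmentedDesign w X l j) *
      (∑ l, R i l * testVector w X ξ θ₀ (Sum.inr true) l)| ≤ N := by
    intro j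
    rw [hJeq (fun l => augmentedDesign w X l j)]
    have h1 : (fun l => augmentedDesign w X l j) ⬝ᵥ testVector w X ξ θ₀ (Sum.inr true)
        = ∑ i, X i j * ξ i - w ^ 2 * θ₀ j := augmentedDesign_dotProduct_elim w X θ₀ j ξ
    rw [h1, mul_add, mul_sub]
    have t1 : |1 / (n : ℝ) * J (tv (Sum.inl j)) (tv (Sum.inr true))|
        ≤ ℓ / √r * (√(b ^ 2 + 1) * √(bn ^ 2 + 2)) := by
      rw [abs_mul, abs_of_pos (by positivity : (0 : ℝ) < 1 / n)]
      calc _ ≤ 1 / (n : ℝ) * (ℓ / √r * ((√n * √(b ^ 2 + 1)) * (√n * √(bn ^ 2 + 2)))) := by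
            gcongr
            refine (hgood.jl _ _).trans ?_
            gcongr
            exact hA j
        _ = 1 / (n : ℝ) * (√n * √n) * (ℓ / √r * (√(b ^ 2 + 1) * √(bn ^ 2 + 2))) := by ring
        _ = _ := by rw [hsn2, one_div_mul_cancel hn0.ne', one_mul]
    have t2 : |1 / (n : ℝ) * ∑ i, X i j * ξ i| ≤ b * bn * (ℓ / √n) := by
      rw [abs_mul, abs_of_pos (by positivity : (0 : ℝ) < 1 / n)]
      calc _ ≤ 1 / (n : ℝ) * (b * bn * ℓ * √n) := by gcongr; exact hgood.cross j
        _ = _ := by rw [hsq]; ring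
    -- The systematic part of the score: the privacy block shrinks towards 0, shifting coordinate j
    -- by w²θ₀ j / n.
    have t3 : |1 / (n : ℝ) * (w ^ 2 * θ₀ j)| ≤ w ^ 2 / n := by
      rw [abs_mul, abs_mul, abs_of_pos (by positivity : (0 : ℝ) < 1 / n),
        abs_of_nonneg (sq_nonneg w)]
      calc _ ≤ 1 / (n : ℝ) * (w ^ 2 * 1) := by gcongr; exact hθle j
        _ = _ := by ring
    calc _ ≤ _ := abs_add_le _ _
      _ ≤ _ := add_le_add t1 ((abs_sub _ _).trans (add_le_add t2 t3))
      _ ≤ N := by linarith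
  have hN0 : 0 ≤ N := le_trans (by positivity) hN
  have he0 : 0 ≤ e := le_trans (by positivity) he
  -- The diagonal value c = 1 + w²/n is the expectation of the private Gram diagonal; the deviation
  -- from c I is the same matrix as in the bias, hence the same e.
  have hl1 := sum_abs_le_of_quadratic_le (c := 1 + w ^ 2 / n) (by simp; positivity) hpe
    (fun j k => ?_) hnoise (hθ.basic_inequality w X ξ θ₀ hn hlam) hN0 hlam
  · refine (pi_norm_le_iff_of_nonneg (by positivity)).2 fun j => ?_
    rw [Real.norm_eq_abs, bias_apply w X ξ θ₀ R hn]
    refine (abs_add_le _ _).trans (add_le_add ?_ ?_)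
    · calc _ ≤ ∑ k, |(θ₀ - θ) k| * e := by
            refine (Finset.abs_sum_le_sum_abs _ _).trans (Finset.sum_le_sum fun k _ => ?_)
            rw [abs_mul]
            exact mul_le_mul_of_nonneg_left (hEM j k) (abs_nonneg _)
        _ = (∑ k, |(θ₀ - θ) k|) * e := by rw [Finset.sum_mul]
        _ ≤ 4 * p * (N + lam) * e := by gcongr
        _ = _ := by ring
    · rw [abs_mul, abs_of_pos (by positivity : (0 : ℝ) < 1 / n)]
      calc _ ≤ 1 / (n : ℝ) * (ℓ / √r * ((√n * √(b ^ 2 + 1)) * (√2 * w))) := by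
            gcongr
            refine (hgood.jl _ _).trans ?_
            gcongr
            · exact hA j
            · exact hv.le
        _ = ℓ / √r * √(b ^ 2 + 1) * √2 * (1 / (n : ℝ) * (w * √n)) := by ring
        _ = _ := by rw [hsq]; ring
  · rw [hJeq (fun l => augmentedDesign w X l j), augmentedDesign_dotProduct]
    refine le_trans (le_of_eq ?_) (hEM j k)
    congr 1
    simp only [Finset.sum_sub_distrib, Finset.sum_const, Finset.card_univ, Fintype.card_fin,
      nsmul_eq_mul, htv, testVector]
    split_ifs
    · field_simp
      ring
    · ring

end

/-! ### Scalar inequalities in the dense regime -/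

/-- Size relations between the scalar parameters, valid for all large `p`. -/
structure Regime (p n s r : ℕ) (σ w : ℝ) : Prop where
  one_le_log : 1 ≤ Real.log p
  r_pos : 0 < r
  r_le : r ≤ n
  s_le : s ≤ p
  σ_pos : 0 < σ
  w_pos : 0 < w
  w_sq_le : w ^ 2 ≤ n
  w_sq_div_le : w ^ 2 / n ≤ σ / √r

namespace Regime

variable {p n s r : ℕ} {σ w : ℝ}

lemma r_pos' (h : Regime p n s r σ w) : (0 : ℝ) < r := by exact_mod_cast h.r_pos

lemma n_pos' (h : Regime p n s r σ w) : (0 : ℝ) < n := by exact_mod_cast h.r_pos.trans_le h.r_le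

lemma sqrt_r_pos (h : Regime p n s r σ w) : 0 < √(r : ℝ) := Real.sqrt_pos.2 h.r_pos'

lemma sqrt_n_pos (h : Regime p n s r σ w) : 0 < √(n : ℝ) := Real.sqrt_pos.2 h.n_pos'

lemma log_pos (h : Regime p n s r σ w) : 0 < Real.log p := by linarith [h.one_le_log]

lemma sqrt_r_le (h : Regime p n s r σ w) : √(r : ℝ) ≤ √(n : ℝ) :=
  Real.sqrt_le_sqrt (by exact_mod_cast h.r_le)

lemma one_le_p (h : Regime p n s r σ w) : (1 : ℝ) ≤ p := by
  rcases Nat.eq_zero_or_pos p with hp | hp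
  · have := h.one_le_log
    simp [hp] at this
    linarith
  · exact_mod_cast hp

lemma w_le (h : Regime p n s r σ w) : w ≤ √(n : ℝ) := Real.le_sqrt_of_sq_le h.w_sq_le

lemma sqrt_log_le (h : Regime p n s r σ w) : √(Real.log p) ≤ Real.log p := by
  rw [Real.sqrt_le_left h.log_pos.le]
  nlinarith [h.one_le_log]

/-- Since r ≤ n and log p ≥ 1, the second term of the maximum wins. -/
lemma penalty_eq (h : Regime p n s r σ w) :
    penalty 1 σ n p r = σ * (√(Real.log p ^ 3) / √r) := by
  rw [penalty, one_mul, max_eq_right, Real.sqrt_div (by have := h.log_pos; positivity)]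
  apply Real.sqrt_le_sqrt
  have hr : (r : ℝ) ≤ n := by exact_mod_cast h.r_le
  have hl : Real.log p ≤ Real.log p ^ 3 := le_self_pow₀ h.one_le_log (by norm_num)
  have := h.r_pos'
  have := h.log_pos
  gcongr

lemma le_penalty (h : Regime p n s r σ w) : σ / √r ≤ penalty 1 σ n p r := by
  rw [h.penalty_eq, ← mul_div_assoc]
  have h1 : 1 ≤ √(Real.log p ^ 3) := Real.one_le_sqrt.2 (one_le_pow₀ h.one_le_log)
  have := h.sqrt_r_pos
  have := h.σ_pos
  gcongr
  nlinarith

lemma penalty_pos (h : Regime p n s r σ w) : 0 < penalty 1 σ n p r :=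
  (div_pos h.σ_pos h.sqrt_r_pos).trans_le h.le_penalty

lemma penalty_le (h : Regime p n s r σ w) :
    penalty 1 σ n p r ≤ σ * (Real.log p ^ 2 / √r) := by
  rw [h.penalty_eq]
  have h1 : √(Real.log p ^ 3) ≤ Real.log p ^ 2 := by
    rw [Real.sqrt_le_left (by have := h.log_pos; positivity), ← pow_mul]
    exact pow_le_pow_right₀ h.one_le_log (by norm_num)
  have := h.sqrt_r_pos
  have := h.σ_pos
  gcongr

lemma kappa_nonneg (h : Regime p n s r σ w) : 0 ≤ kappa (penalty 1 σ n p r) n s w := by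
  have := h.penalty_pos
  rw [kappa]; positivity

/-- The term w²/n is at most σ/√r ≤ λ ≤ λ√p, which adds one to the factor 2. -/
lemma kappa_le (h : Regime p n s r σ w) :
    kappa (penalty 1 σ n p r) n s w ≤ 3 * penalty 1 σ n p r * √p := by
  have h1 : √(s : ℝ) ≤ √(p : ℝ) := Real.sqrt_le_sqrt (by exact_mod_cast h.s_le)
  have h2 : 1 ≤ √(p : ℝ) := Real.one_le_sqrt.2 h.one_le_p
  have h3 := h.w_sq_div_le.trans h.le_penalty
  have h4 := h.penalty_pos
  rw [kappa]
  nlinarith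

lemma one_le_phiW (h : Regime p n s r σ w) : 1 ≤ phiW n w := by
  have := h.n_pos'
  rw [phiW]
  have : 0 ≤ w ^ 2 / n := by positivity
  linarith

lemma kappa_sq_le (h : Regime p n s r σ w) :
    kappa (penalty 1 σ n p r) n s w ^ 2 ≤ 9 * penalty 1 σ n p r ^ 2 * p := by
  calc _ ≤ (3 * penalty 1 σ n p r * √p) ^ 2 := pow_le_pow_left₀ h.kappa_nonneg h.kappa_le 2
    _ = 9 * penalty 1 σ n p r ^ 2 * (√p ^ 2) := by ring
    _ = _ := by rw [Real.sq_sqrt (by positivity)]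

lemma one_div_sqrt_le_rho (h : Regime p n s r σ w) : 1 / √r ≤ rho n r w := by
  rw [rho, ← Real.sqrt_one, ← Real.sqrt_div zero_le_one, Real.sqrt_one]
  apply Real.sqrt_le_sqrt
  have hr := h.r_pos'
  have hn := h.n_pos'
  have h1 : 1 / (r : ℝ) = n / (n * r) := by field_simp
  rw [h1]
  have h2 : (n : ℝ) / (n * r) ≤ ((n : ℝ) + r + 1) / (n * r) := by gcongr; linarith
  have h3 : 0 ≤ w ^ 2 / (n * r) := by positivity
  linarith

lemma inv_rho_le (h : Regime p n s r σ w) : 1 / (σ * rho n r w) ≤ √r / σ := by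
  have h1 := h.one_div_sqrt_le_rho
  have h2 := h.sqrt_r_pos
  have h3 := h.σ_pos
  have h4 : 0 < 1 / √(r : ℝ) := by positivity
  rw [div_le_div_iff₀ (mul_pos h3 (h4.trans_le h1)) h3]
  calc 1 * σ = √r * (σ * (1 / √r)) := by field_simp
    _ ≤ _ := by gcongr

lemma inv_rho_nonneg (h : Regime p n s r σ w) : 0 ≤ 1 / (σ * rho n r w) := by
  have := h.σ_pos
  rw [rho]; positivity

lemma sqrt_r_div_log_le (h : Regime p n s r σ w) : √r / Real.log p ≤ √(r / Real.log p) := by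
  rw [Real.sqrt_div h.r_pos'.le]
  have := Real.sqrt_pos.2 h.log_pos
  exact div_le_div_of_nonneg_left h.sqrt_r_pos.le this h.sqrt_log_le

lemma sqrt_r_div_log_le' (h : Regime p n s r σ w) : √r / Real.log p ≤ √(n / Real.log p) := by
  refine h.sqrt_r_div_log_le.trans (Real.sqrt_le_sqrt ?_)
  have := h.log_pos
  have hr : (r : ℝ) ≤ n := by exact_mod_cast h.r_le
  gcongr

/-- Because r ≤ n and w² ≤ n, all three branches of the minimum give at least √(r / log p);
replacing √(log p) by log p is harmless. -/
lemma compatibility_rhs (h : Regime p n s r σ w) :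
    √r / Real.log p ≤ √((n : ℝ) / Real.log p) *
        min 1 (min √((r : ℝ) / n) (√((r : ℝ) * n) / w ^ 2)) := by
  have hl := h.log_pos
  have hr := h.r_pos'
  have hn := h.n_pos'
  have hw := h.w_pos
  rw [mul_min_of_nonneg _ _ (Real.sqrt_nonneg _), mul_min_of_nonneg _ _ (Real.sqrt_nonneg _),
    mul_one]
  refine le_min h.sqrt_r_div_log_le' (le_min ?_ ?_)
  · rw [← Real.sqrt_mul (by positivity)]
    refine h.sqrt_r_div_log_le.trans (Real.sqrt_le_sqrt (le_of_eq ?_))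
    field_simp
  · refine h.sqrt_r_div_log_le.trans ?_
    have h1 : √((r : ℝ) * n) / n ≤ √((r : ℝ) * n) / w ^ 2 :=
      div_le_div_of_nonneg_left (Real.sqrt_nonneg _) (by positivity) h.w_sq_le
    have h2 : √((r : ℝ) * n) / n = √(r / n) := by
      rw [Real.sqrt_mul hr.le, Real.sqrt_div hr.le, div_eq_div_iff hn.ne' h.sqrt_n_pos.ne',
        mul_assoc, Real.mul_self_sqrt hn.le]
    calc _ = √((n : ℝ) / Real.log p) * (√((r : ℝ) * n) / n) := by
          rw [h2, ← Real.sqrt_mul (by positivity)]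
          congr 1
          field_simp
      _ ≤ _ := by gcongr

lemma compatibility_le (h : Regime p n s r σ w) :
    kappa (penalty 1 σ n p r) n s w ^ 2 / (penalty 1 σ n p r ^ 2 * phiW n w) ≤
      9 * (p * Real.log p ^ 3 / √r) * (√((n : ℝ) / Real.log p) *
        min 1 (min √((r : ℝ) / n) (√((r : ℝ) * n) / w ^ 2))) := by
  have h1 := h.penalty_pos
  have h2 := h.one_le_phiW
  have hl := h.log_pos
  have hs := h.sqrt_r_pos
  calc _ ≤ 9 * penalty 1 σ n p r ^ 2 * p / (penalty 1 σ n p r ^ 2 * 1) := by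
        gcongr
        exact h.kappa_sq_le
    _ = 9 * (p * 1) := by field_simp
    -- A lossy logarithmic factor, inserted so that the prefactor becomes the null sequence p (log
    -- p)³ / √r shared by all estimates.
    _ ≤ 9 * (p * Real.log p ^ 2) := by
        gcongr
        exact one_le_pow₀ h.one_le_log
    _ = 9 * (p * Real.log p ^ 3 / √r) * (√r / Real.log p) := by field_simp
    _ ≤ _ := by gcongr; exact h.compatibility_rhs

lemma sparsity_rhs (h : Regime p n s r σ w) :
    √r / (w / √n * Real.log p) ≤ min ((n : ℝ) / w ^ 2 * √((r : ℝ) / Real.log p))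
        (√((n : ℝ) * r) / (w * Real.log p)) := by
  have hl := h.log_pos
  have hr := h.r_pos'
  have hn := h.n_pos'
  have hsn := h.sqrt_n_pos
  have hw := h.w_pos
  have h1 : √r / (w / √n * Real.log p) = √n / w * (√r / Real.log p) := by field_simp
  refine le_min ?_ (le_of_eq ?_)
  · rw [h1]
    have h2 : √(n : ℝ) / w ≤ n / w ^ 2 := by
      rw [div_le_div_iff₀ hw (by positivity)]
      calc √(n : ℝ) * w ^ 2 = √n * w * w := by ring
        _ ≤ √n * √n * w := by have := h.w_le; gcongr
        _ = n * w := by rw [Real.mul_self_sqrt hn.le]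
    have := h.sqrt_r_div_log_le
    gcongr
  · rw [h1, Real.sqrt_mul hn.le]
    field_simp

lemma sparsity_le (h : Regime p n s r σ w) :
    1 / (σ * rho n r w) * √(s : ℝ) ≤
      1 / σ * (Real.log p * (√p * (w / √n))) * min ((n : ℝ) / w ^ 2 * √((r : ℝ) / Real.log p))
        (√((n : ℝ) * r) / (w * Real.log p)) := by
  have hl := h.log_pos
  have hsr := h.sqrt_r_pos
  have hsn := h.sqrt_n_pos
  have hw := h.w_pos
  have hσ := h.σ_pos
  have h1 : √(s : ℝ) ≤ √(p : ℝ) := Real.sqrt_le_sqrt (by exact_mod_cast h.s_le)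
  calc _ ≤ √r / σ * √p := by
        have := h.inv_rho_le
        gcongr
    _ = 1 / σ * (Real.log p * (√p * (w / √n))) * (√r / (w / √n * Real.log p)) := by field_simp
    _ ≤ _ := by gcongr; exact h.sparsity_rhs

/-- The branch log p / √r of the numerator, against a denominator of at most (w/√n)(log p / √r),
leaves √n / w, and this is at least √p by `hV`. -/
lemma penalty_level_le (h : Regime p n s r σ w) (hV : √p * (w / √n) ≤ 1) :
    √(s : ℝ) ≤ max (1 / √(n : ℝ)) (Real.log p / √(r : ℝ)) /
        max (w * Real.log p / √((n : ℝ) * r)) (w ^ 2 / n * √(Real.log p / r)) := by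
  have hl := h.log_pos
  have hr := h.r_pos'
  have hn := h.n_pos'
  have hsr := h.sqrt_r_pos
  have hsn := h.sqrt_n_pos
  have hw := h.w_pos
  have h1 : √(s : ℝ) ≤ √(p : ℝ) := Real.sqrt_le_sqrt (by exact_mod_cast h.s_le)
  have hV0 : 0 < w / √n := by positivity
  have hden : max (w * Real.log p / √((n : ℝ) * r)) (w ^ 2 / n * √(Real.log p / r))
      ≤ w / √n * (Real.log p / √r) := by
    refine max_le (le_of_eq ?_) ?_
    · rw [Real.sqrt_mul hn.le]; field_simp
    · have h2 : w ^ 2 / n = w / √n * (w / √n) := by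
        rw [div_mul_div_comm, Real.mul_self_sqrt hn.le, sq]
      have h3 : w / √n ≤ 1 := (div_le_one hsn).2 h.w_le
      rw [h2, Real.sqrt_div hl.le]
      have h4 := h.sqrt_log_le
      calc _ ≤ w / √n * 1 * (Real.log p / √r) := by gcongr
        _ = _ := by ring
  have hdpos : 0 < max (w * Real.log p / √((n : ℝ) * r)) (w ^ 2 / n * √(Real.log p / r)) :=
    lt_max_of_lt_left (by positivity)
  calc √(s : ℝ) ≤ √p := h1
    _ ≤ 1 / (w / √n) := by rw [le_div_iff₀ hV0]; exact hV
    _ = (Real.log p / √r) / (w / √n * (Real.log p / √r)) := by field_simp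
    _ ≤ _ := by
      apply div_le_div₀ _ (le_max_right _ _) hdpos hden
      exact le_max_of_le_left (by positivity)

/-- The factor √r / σ bounding 1/(σρ) cancels against λ ≤ σ (log p)² / √r, leaving 36 p (log p)²;
every branch of the minimum is at least √r / log p. -/
lemma error_le (h : Regime p n s r σ w) :
    1 / (σ * rho n r w) * (4 * kappa (penalty 1 σ n p r) n s w ^ 2 /
          (penalty 1 σ n p r * phiW n w)) ≤
      36 * (p * Real.log p ^ 3 / √r) * min √((n : ℝ) / Real.log p)
        (min √((r : ℝ) / Real.log p)
          (min ((n : ℝ) / w ^ 2 * √((r : ℝ) / Real.log p))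
            (√((n : ℝ) * r) / (w * Real.log p)))) := by
  have h1 := h.penalty_pos
  have h2 := h.one_le_phiW
  have hl := h.log_pos
  have hs := h.sqrt_r_pos
  have hsn := h.sqrt_n_pos
  have hσ := h.σ_pos
  have hw := h.w_pos
  have hmin : √r / Real.log p ≤ √r / (w / √n * Real.log p) := by
    apply div_le_div_of_nonneg_left hs.le (by positivity)
    have h3 : w / √n ≤ 1 := (div_le_one hsn).2 h.w_le
    nlinarith
  calc _ ≤ √r / σ * (4 * (9 * penalty 1 σ n p r ^ 2 * p) / (penalty 1 σ n p r * 1)) := by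
        have h3 := h.inv_rho_le
        have h4 := h.kappa_sq_le
        have h5 := h.inv_rho_nonneg
        gcongr
    _ = √r / σ * 36 * p * penalty 1 σ n p r := by field_simp; ring
    _ ≤ √r / σ * 36 * p * (σ * (Real.log p ^ 2 / √r)) := by
        have h3 := h.penalty_le
        gcongr
    _ = 36 * (p * Real.log p ^ 3 / √r) * (√r / Real.log p) := by field_simp
    _ ≤ _ := by
        have h3 := le_min h.sqrt_r_div_log_le'
          (le_min h.sqrt_r_div_log_le (hmin.trans h.sparsity_rhs))
        gcongr

/-- The bias bound on the good event, in units of the noise level. -/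
theorem norm_bias_div_le (h : Regime p n s r σ w) {b bn K σ₁ σ₂ : ℝ} (hb : 0 ≤ b) (hbn : 0 ≤ bn)
    (hbnK : bn ≤ K * Real.log p) (hσ₁ : 0 < σ₁) (hσ₁σ : σ₁ ≤ σ) (hσ₂ : σ ≤ σ₂)
    (hsmall : (b ^ 2 + 1) * (p * Real.log p ^ 3 / √r) ≤ 1 / 4)
    {X : Matrix (Fin n) (Fin p) ℝ} {ξ : Fin n → ℝ}
    {θ₀ θ : Fin p → ℝ} {R : Matrix (Fin r) (Fin n ⊕ (Fin p ⊕ Unit)) ℝ}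
    (hgood : IsGood b bn w (Real.log p) X ξ R θ₀) (hθ₀ : ∑ j, θ₀ j ^ 2 = 1)
    (hθ : IsPrivateLasso (penalty 1 σ n p r) w X (X.mulVec θ₀ + ξ) R θ) :
    ‖bias w X R θ₀ θ‖ / (σ * rho n r w) ≤
      1 / σ₁ * (8 * (b ^ 2 + 1) * (b * K + (b + 1) * (K + 2) + 2 * σ₂)
          * (p * Real.log p ^ 3 / √r)
        + 2 * (b + 1) * (Real.log p * (√p * (w / √n)))) := by
  have hl := h.log_pos
  have hl1 := h.one_le_log
  have hr := h.sqrt_r_pos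
  have hn := h.sqrt_n_pos
  have hw := h.w_pos
  have hσ := h.σ_pos
  have hn' : 0 < n := h.r_pos.trans_le h.r_le
  set ℓ := Real.log p with hℓ
  have hσ₂0 : 0 ≤ σ₂ := hσ.le.trans hσ₂
  have hK : 0 ≤ K := by nlinarith
  have hℓn : ℓ / √n ≤ ℓ / √r := div_le_div_of_nonneg_left hl.le hr h.sqrt_r_le
  have hℓ2 : ℓ ≤ ℓ ^ 2 := le_self_pow₀ hl1 (by norm_num)
  have hℓ3 : ℓ ≤ ℓ ^ 3 := le_self_pow₀ hl1 (by norm_num)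
  have he : (b ^ 2 + 1) * (ℓ / √n) + (b ^ 2 + 1) * (ℓ / √r) ≤ 2 * (b ^ 2 + 1) * (ℓ / √r) := by
    have : (b ^ 2 + 1) * (ℓ / √n) ≤ (b ^ 2 + 1) * (ℓ / √r) := by gcongr
    linarith
  have hpe : p * (2 * (b ^ 2 + 1) * (ℓ / √r)) ≤ 1 / 2 := by
    calc _ = 2 * ((b ^ 2 + 1) * (p * ℓ / √r)) := by ring
      _ ≤ 2 * ((b ^ 2 + 1) * (p * ℓ ^ 3 / √r)) := by gcongr
      _ ≤ _ := by linarith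
  have hN : b * bn * (ℓ / √n) + w ^ 2 / n + ℓ / √r * (√(b ^ 2 + 1) * √(bn ^ 2 + 2)) ≤
      (b * K + (b + 1) * (K + 2) + σ₂) * (ℓ ^ 2 / √r) := by
    have t1 : b * bn * (ℓ / √n) ≤ b * (K * ℓ) * (ℓ / √r) := by gcongr
    have t2 : w ^ 2 / n ≤ σ₂ * (ℓ ^ 2 / √r) := by
      refine h.w_sq_div_le.trans ?_
      calc σ / √r = σ * (1 / √r) := by ring
        _ ≤ σ₂ * (ℓ ^ 2 / √r) := by gcongr; exact hl1.trans hℓ2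
    have t3 : √(b ^ 2 + 1) ≤ b + 1 := by
      rw [Real.sqrt_le_left (by positivity)]; nlinarith
    have t4 : √(bn ^ 2 + 2) ≤ (K + 2) * ℓ := by
      have : √(bn ^ 2 + 2) ≤ bn + 2 := by
        rw [Real.sqrt_le_left (by positivity)]; nlinarith
      nlinarith
    have t5 : ℓ / √r * (√(b ^ 2 + 1) * √(bn ^ 2 + 2)) ≤ ℓ / √r * ((b + 1) * ((K + 2) * ℓ)) := by
      gcongr
    calc _ ≤ b * (K * ℓ) * (ℓ / √r) + σ₂ * (ℓ ^ 2 / √r) + ℓ / √r * ((b + 1) * ((K + 2) * ℓ)) := by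
          linarith
      _ = _ := by ring
  have hmain := hgood.norm_bias_le hn' hw.le h.w_sq_le hb hbn hl.le h.penalty_pos.le hθ₀ he hpe hN hθ
  have hlam : penalty 1 σ n p r ≤ σ₂ * (ℓ ^ 2 / √r) := h.penalty_le.trans (by gcongr)
  have t3 : √(b ^ 2 + 1) ≤ b + 1 := by
    rw [Real.sqrt_le_left (by positivity)]; nlinarith
  have t6 : √(2 : ℝ) ≤ 2 := by rw [Real.sqrt_le_left (by norm_num)]; norm_num
  have hp1 : 1 ≤ √(p : ℝ) := Real.one_le_sqrt.2 h.one_le_p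
  have hbound : ‖bias w X R θ₀ θ‖ ≤
      (8 * (b ^ 2 + 1) * (b * K + (b + 1) * (K + 2) + 2 * σ₂) * (p * ℓ ^ 3 / √r)
        + 2 * (b + 1) * (ℓ * (√p * (w / √n)))) * (1 / √r) := by
    refine hmain.trans ?_
    calc _ ≤ 4 * p * (2 * (b ^ 2 + 1) * (ℓ / √r)) *
          ((b * K + (b + 1) * (K + 2) + σ₂) * (ℓ ^ 2 / √r) + σ₂ * (ℓ ^ 2 / √r)) +
          ℓ / √r * ((b + 1) * (2 * (√p * (w / √n)))) := by
          gcongr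
          -- An unneeded √p is inserted so that the last term matches the null sequence log p · √p ·
          -- w / √n.
          exact le_mul_of_one_le_left (by positivity) hp1
      _ = _ := by ring
  rw [div_eq_mul_one_div]
  have hinv : 1 / (σ * rho n r w) ≤ √r / σ₁ := h.inv_rho_le.trans (by gcongr)
  calc _ ≤ _ := mul_le_mul hbound hinv h.inv_rho_nonneg (by positivity)
    _ = _ := by field_simp

end Regime

/-! ### Asymptotics of the parameters -/

lemma tendsto_log_pow_mul_rpow_neg (k : ℕ) {c : ℝ} (hc : 0 < c) :
    Tendsto (fun p : ℕ => Real.log p ^ k * (p : ℝ) ^ (-c)) atTop (𝓝 0) := by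
  have h := (isLittleO_log_rpow_rpow_atTop (k : ℝ) hc).tendsto_div_nhds_zero.comp
    tendsto_natCast_atTop_atTop
  refine h.congr fun p => ?_
  simp only [Function.comp_apply, Real.rpow_natCast]
  rw [Real.rpow_neg (Nat.cast_nonneg p), div_eq_mul_inv]

lemma tendsto_log_natCast : Tendsto (fun p : ℕ => Real.log p) atTop atTop :=
  Real.tendsto_log_atTop.comp tendsto_natCast_atTop_atTop

lemma tendsto_rpow_natCast {c : ℝ} (hc : 0 < c) :
    Tendsto (fun p : ℕ => (p : ℝ) ^ c) atTop atTop :=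
  (tendsto_rpow_atTop hc).comp tendsto_natCast_atTop_atTop

/-- The projection dimension `⌈p ^ (2 + τ)⌉`. -/
noncomputable def projDim (τ : ℝ) (p : ℕ) : ℕ := ⌈(p : ℝ) ^ (2 + τ)⌉₊

lemma le_projDim (τ : ℝ) (p : ℕ) : (p : ℝ) ^ (2 + τ) ≤ projDim τ p := Nat.le_ceil _

lemma projDim_le {τ : ℝ} (hτ : 0 < τ) {p : ℕ} (hp : 1 ≤ p) :
    (projDim τ p : ℝ) ≤ 2 * (p : ℝ) ^ (2 + τ) := by
  have h1 : (projDim τ p : ℝ) < (p : ℝ) ^ (2 + τ) + 1 := Nat.ceil_lt_add_one (by positivity)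
  have h2 : (1 : ℝ) ≤ (p : ℝ) ^ (2 + τ) :=
    Real.one_le_rpow (by exact_mod_cast hp) (by linarith)
  linarith

lemma tendsto_projDim {τ : ℝ} (hτ : 0 < τ) : Tendsto (projDim τ) atTop atTop :=
  tendsto_nat_ceil_atTop.comp (tendsto_rpow_natCast (by linarith))

lemma rpow_le_sqrt_projDim (τ : ℝ) (p : ℕ) : (p : ℝ) ^ (1 + τ / 2) ≤ √(projDim τ p : ℝ) := by
  apply Real.le_sqrt_of_sq_le
  rw [← Real.rpow_natCast, ← Real.rpow_mul (Nat.cast_nonneg p)]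
  convert le_projDim τ p using 2
  push_cast
  ring

/-- Here r must exceed p² by a power: √r ≥ p^(1 + τ/2) leaves p^(-τ/2) to absorb the logarithms. -/
lemma tendsto_mul_log_pow_div_sqrt_projDim {τ : ℝ} (hτ : 0 < τ) :
    Tendsto (fun p : ℕ => p * Real.log p ^ 3 / √(projDim τ p : ℝ)) atTop (𝓝 0) := by
  refine squeeze_zero' ?_ ?_ (tendsto_log_pow_mul_rpow_neg 3 (half_pos hτ))
  · filter_upwards [eventually_ge_atTop 1] with p hp
    have : 0 ≤ Real.log p := Real.log_natCast_nonneg p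
    positivity
  · filter_upwards [eventually_ge_atTop 1] with p hp
    have hp0 : (0 : ℝ) < p := by exact_mod_cast hp
    have hl : 0 ≤ Real.log p := Real.log_natCast_nonneg p
    have h1 : 0 < (p : ℝ) ^ (1 + τ / 2) := Real.rpow_pos_of_pos hp0 _
    calc _ ≤ p * Real.log p ^ 3 / (p : ℝ) ^ (1 + τ / 2) := by
          gcongr
          exact rpow_le_sqrt_projDim τ p
      _ = _ := by
          rw [Real.rpow_add hp0, Real.rpow_one, Real.rpow_neg hp0.le]
          field_simp

lemma eventually_rpow_div_two_le {α : ℝ} (hα : 0 < α) {n : ℕ → ℕ}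
    (hn : ∀ p : ℕ, |(n p : ℝ) - (p : ℝ) ^ α| ≤ 1) :
    ∀ᶠ p : ℕ in atTop, (p : ℝ) ^ α / 2 ≤ n p ∧ (n p : ℝ) ≤ 2 * (p : ℝ) ^ α := by
  filter_upwards [(tendsto_rpow_natCast hα).eventually_ge_atTop 2] with p hp
  have := abs_le.1 (hn p)
  constructor <;> linarith

lemma eventually_projDim_le {α τ : ℝ} (hτ : 0 < τ) (hτα : 2 + τ < α) {n : ℕ → ℕ}
    (hn : ∀ p : ℕ, |(n p : ℝ) - (p : ℝ) ^ α| ≤ 1) :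
    ∀ᶠ p : ℕ in atTop, projDim τ p ≤ n p := by
  filter_upwards [eventually_rpow_div_two_le (by linarith) hn, eventually_ge_atTop 1,
    (tendsto_rpow_natCast (sub_pos.2 hτα)).eventually_ge_atTop 4] with p h1 hp h2
  have hp0 : (0 : ℝ) < p := by exact_mod_cast hp
  have h3 := projDim_le hτ hp
  have h4 : (p : ℝ) ^ α = (p : ℝ) ^ (2 + τ) * (p : ℝ) ^ (α - (2 + τ)) := by
    rw [← Real.rpow_add hp0]; ring_nf
  have h5 : 0 < (p : ℝ) ^ (2 + τ) := Real.rpow_pos_of_pos hp0 _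
  have : (projDim τ p : ℝ) ≤ n p := by nlinarith
  exact_mod_cast this

lemma eventually_sparsity_le {c₀ : ℝ} (hc : c₀ < 1) {s₀ : ℕ → ℕ}
    (hs : ∀ p : ℕ, |(s₀ p : ℝ) - c₀ * p| ≤ 1) : ∀ᶠ p : ℕ in atTop, s₀ p ≤ p := by
  have h : Tendsto (fun p : ℕ => (1 - c₀) * (p : ℝ)) atTop atTop :=
    tendsto_natCast_atTop_atTop.const_mul_atTop (sub_pos.2 hc)
  filter_upwards [h.eventually_ge_atTop 1] with p hp
  have := (abs_le.1 (hs p)).2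
  have : (s₀ p : ℝ) ≤ p := by linarith
  exact_mod_cast this

lemma exists_log_four_div_le {δ : ℕ → ℝ} (hδ : ∀ p : ℕ, 0 < δ p ∧ δ p < 1)
    (h : (fun p : ℕ => Real.log (1 / δ p)) =O[atTop] fun p : ℕ => Real.log p) :
    ∃ K : ℝ, 1 ≤ K ∧ ∀ᶠ p : ℕ in atTop, Real.log (4 / δ p) ≤ K * Real.log p := by
  obtain ⟨c, hc⟩ := h.bound
  refine ⟨max c 0 + Real.log 4 + 1, ?_, ?_⟩
  · have h1 : 0 ≤ Real.log 4 := Real.log_nonneg (by norm_num)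
    linarith [le_max_right c 0]
  · filter_upwards [hc, tendsto_log_natCast.eventually_ge_atTop 1] with p h1 h2
    have h3 : Real.log (4 / δ p) = Real.log 4 + Real.log (1 / δ p) := by
      rw [← Real.log_mul (by norm_num) (one_div_pos.2 (hδ p).1).ne']
      congr 1; ring
    rw [Real.norm_eq_abs, Real.norm_eq_abs, abs_of_nonneg (by linarith : 0 ≤ Real.log p)] at h1
    have h4 : Real.log (1 / δ p) ≤ max c 0 * Real.log p :=
      (le_abs_self _).trans (h1.trans (by gcongr; exact le_max_left _ _))
    have h5 : 0 ≤ Real.log 4 := Real.log_nonneg (by norm_num)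
    nlinarith

lemma exists_truncation_le {α : ℝ} (hα : 0 < α) {n : ℕ → ℕ}
    (hn : ∀ p : ℕ, |(n p : ℝ) - (p : ℝ) ^ α| ≤ 1) {σ bn : ℕ → ℝ} (hσ : ∀ p, 0 < σ p) {σ₂ : ℝ}
    (hσ₂ : ∀ᶠ p in atTop, σ p ≤ σ₂)
    (hbn : bn =O[atTop] fun p : ℕ => σ p * √(Real.log (n p))) :
    ∃ K : ℝ, 0 ≤ K ∧ ∀ᶠ p : ℕ in atTop, bn p ≤ K * Real.log p := by
  obtain ⟨c, hc⟩ := hbn.bound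
  obtain ⟨p₀, hp₀⟩ := hσ₂.exists
  have hσ₂0 : 0 ≤ σ₂ := (hσ p₀).le.trans hp₀
  refine ⟨max c 0 * (σ₂ * (1 + α)), by positivity, ?_⟩
  filter_upwards [hc, hσ₂, tendsto_log_natCast.eventually_ge_atTop 1,
    eventually_rpow_div_two_le hα hn, eventually_ge_atTop 1,
    (tendsto_rpow_natCast hα).eventually_ge_atTop 2] with p h1 h2 h3 h4 hp h5
  have hp0 : (0 : ℝ) < p := by exact_mod_cast hp
  have hlog : Real.log (n p) ≤ (1 + α) * Real.log p := by
    have hn0 : (0 : ℝ) < n p := by linarith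
    calc Real.log (n p) ≤ Real.log (2 * (p : ℝ) ^ α) := Real.log_le_log hn0 h4.2
      _ = Real.log 2 + α * Real.log p := by
          rw [Real.log_mul (by norm_num) (by positivity), Real.log_rpow hp0]
      _ ≤ _ := by
          have : Real.log 2 ≤ 1 := by linarith [Real.log_two_lt_d9]
          linarith
  have hsq : √(Real.log (n p)) ≤ (1 + α) * Real.log p := by
    have hx : 1 ≤ (1 + α) * Real.log p := by nlinarith
    refine (Real.sqrt_le_sqrt hlog).trans ?_
    rw [Real.sqrt_le_left (by linarith)]
    nlinarith
  rw [Real.norm_eq_abs, Real.norm_eq_abs,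
    abs_of_nonneg (mul_nonneg (hσ p).le (Real.sqrt_nonneg _))] at h1
  have hσp := hσ p
  calc bn p ≤ c * (σ p * √(Real.log (n p))) := (le_abs_self _).trans h1
    _ ≤ max c 0 * (σ₂ * ((1 + α) * Real.log p)) := by
        gcongr
        exact le_max_left _ _
    _ = _ := by ring

lemma eventually_truncation_pos {n : ℕ → ℕ} {σ bn : ℕ → ℝ} (hσ : ∀ p, 0 < σ p)
    (h : Tendsto (fun p : ℕ => bn p / σ p - √(2 * Real.log (2 * n p))) atTop atTop) :
    ∀ᶠ p in atTop, 0 < bn p := by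
  filter_upwards [h.eventually_ge_atTop 1] with p hp
  have h1 : 0 < bn p / σ p := by
    have := Real.sqrt_nonneg (2 * Real.log (2 * n p))
    linarith
  have := mul_pos h1 (hσ p)
  rwa [div_mul_cancel₀ _ (hσ p).ne'] at this

lemma pos_of_variance_eq_one {D : Measure ℝ} [IsProbabilityMeasure D] {b : ℝ}
    (hD : ∀ᵐ x ∂D, |x| ≤ b) (h0 : ∫ x, x ∂D = 0) (h1 : ProbabilityTheory.variance id D = 1) :
    0 < b := by
  by_contra hb
  have h2 : ∫ x, x ^ 2 ∂D = ∫ _, (0 : ℝ) ∂D := by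
    refine integral_congr_ae ?_
    filter_upwards [hD] with x hx
    have : |x| ≤ 0 := hx.trans (not_lt.1 hb)
    simp [abs_nonpos_iff.1 this]
  rw [integral_sq_eq_one h0 h1] at h2
  simp at h2

lemma eventually_rowBound_sq_le {s₀ : ℕ → ℕ} {b : ℝ} (hb : 0 ≤ b) {bn : ℕ → ℝ} {K : ℝ}
    (hs : ∀ᶠ p : ℕ in atTop, s₀ p ≤ p) (hbn : ∀ᶠ p : ℕ in atTop, bn p ≤ K * Real.log p)
    (hbn0 : ∀ᶠ p : ℕ in atTop, 0 < bn p) :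
    ∀ᶠ p : ℕ in atTop, rowBound p (s₀ p) b (bn p) ^ 2 ≤ (4 * b ^ 2 + 2 * K ^ 2) * p := by
  have hlim := tendsto_log_pow_mul_rpow_neg 2 one_pos
  filter_upwards [hs, hbn, hbn0, hlim.eventually_le_const one_pos, eventually_ge_atTop 1]
    with p h1 h2 h3 h4 hp
  have hp0 : (0 : ℝ) < p := by exact_mod_cast hp
  have h5 : Real.log p ^ 2 ≤ p := by
    rwa [Real.rpow_neg_one, ← div_eq_mul_inv, div_le_one hp0] at h4
  rw [rowBound, Real.sq_sqrt (by positivity)]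
  have h6 : √(s₀ p : ℝ) ^ 2 ≤ p := by
    rw [Real.sq_sqrt (Nat.cast_nonneg _)]; exact_mod_cast h1
  have h7 : bn p ^ 2 ≤ K ^ 2 * p := by
    calc bn p ^ 2 ≤ (K * Real.log p) ^ 2 := pow_le_pow_left₀ h3.le h2 2
      _ = K ^ 2 * Real.log p ^ 2 := by ring
      _ ≤ _ := by gcongr
  have h8 : (b * √(s₀ p : ℝ) + bn p) ^ 2 ≤ 2 * (b ^ 2 * √(s₀ p : ℝ) ^ 2) + 2 * bn p ^ 2 := by
    nlinarith [sq_nonneg (b * √(s₀ p : ℝ) - bn p)]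
  have h9 : b ^ 2 * √(s₀ p : ℝ) ^ 2 ≤ b ^ 2 * p := by gcongr
  linarith

lemma privacyW_sq {B ε δ : ℝ} (hε : 0 < ε) (hδ : 0 < δ) (hδ1 : δ < 1) (r : ℕ) :
    privacyW B ε δ r ^ 2
      = 4 * B ^ 2 / ε * (√(2 * r * Real.log (4 / δ)) + Real.log (4 / δ)) := by
  have : 0 < Real.log (4 / δ) := Real.log_pos (by rw [lt_div_iff₀ hδ]; linarith)
  rw [privacyW, Real.sq_sqrt (by positivity)]

lemma privacyW_pos {B ε δ : ℝ} (hB : 0 < B) (hε : 0 < ε) (hδ : 0 < δ) (hδ1 : δ < 1) (r : ℕ) :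
    0 < privacyW B ε δ r := by
  have : 0 < Real.log (4 / δ) := Real.log_pos (by rw [lt_div_iff₀ hδ]; linarith)
  rw [privacyW]
  positivity

lemma rowBound_pos {p : ℕ} (hp : 1 ≤ p) (s₀ : ℕ) {b : ℝ} (hb : 0 < b) (bn : ℝ) :
    0 < rowBound p s₀ b bn := by
  have hp0 : (0 : ℝ) < p := by exact_mod_cast hp
  rw [rowBound]
  positivity

/-- With B² = O(p), ε = p^γ and log(4/δ) = O(log p), w² is of order at most p^(1-γ) √r log p. Hence
√r w²/n is at most of order r p^(1-γ-α) log p, that is p^(3+τ-γ-α) log p, and 2τ ≤ α + γ - 3 makes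
the exponent at most -τ. -/
lemma tendsto_sqrt_projDim_mul {α γ τ : ℝ} (hτ : 0 < τ) (hα : 0 < α)
    (hτγ : 2 * τ ≤ α + γ - 3) {n : ℕ → ℕ} (hn : ∀ p : ℕ, |(n p : ℝ) - (p : ℝ) ^ α| ≤ 1)
    {δ : ℕ → ℝ} (hδ : ∀ p : ℕ, 0 < δ p ∧ δ p < 1) {K₁ K₂ : ℝ} (hK₁ : 0 ≤ K₁) (hK₂ : 1 ≤ K₂)
    (hδK : ∀ᶠ p : ℕ in atTop, Real.log (4 / δ p) ≤ K₂ * Real.log p)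
    {B w : ℕ → ℝ} (hB : ∀ᶠ p : ℕ in atTop, B p ^ 2 ≤ K₁ * p)
    (hw : ∀ p : ℕ, w p = privacyW (B p) ((p : ℝ) ^ γ) (δ p) (projDim τ p)) :
    Tendsto (fun p : ℕ => √(projDim τ p : ℝ) * (w p ^ 2 / n p)) atTop (𝓝 0) := by
  have hlim := (tendsto_log_pow_mul_rpow_neg 1 hτ).const_mul (48 * K₁ * K₂)
  rw [mul_zero] at hlim
  refine squeeze_zero' (Eventually.of_forall fun p => by positivity) ?_ hlim
  filter_upwards [hδK, hB, eventually_ge_atTop 1, eventually_rpow_div_two_le hα hn,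
    tendsto_log_natCast.eventually_ge_atTop 1] with p h1 h2 hp h3 h4
  have hp1 : (1 : ℝ) ≤ p := by exact_mod_cast hp
  have hp0 : (0 : ℝ) < p := by linarith
  have hγ : 0 < (p : ℝ) ^ γ := Real.rpow_pos_of_pos hp0 _
  have hα' : 0 < (p : ℝ) ^ α := Real.rpow_pos_of_pos hp0 _
  have hr1 : (1 : ℝ) ≤ projDim τ p :=
    (Real.one_le_rpow hp1 (by linarith)).trans (le_projDim τ p)
  have hsr1 : 1 ≤ √(projDim τ p : ℝ) := Real.one_le_sqrt.2 hr1
  rw [hw, privacyW_sq hγ (hδ p).1 (hδ p).2]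
  have hKl : 1 ≤ K₂ * Real.log p := by nlinarith
  set r : ℝ := ((projDim τ p : ℕ) : ℝ) with hr
  set L := Real.log (4 / δ p) with hL
  set ℓ := Real.log p with hℓ
  have h5 : √(2 * r * L) + L ≤ 3 * K₂ * ℓ * √r := by
    have t1 : √(2 * r * L) ≤ √r * (2 * (K₂ * ℓ)) := by
      rw [show 2 * r * L = r * (2 * L) by ring, Real.sqrt_mul (by linarith)]
      gcongr
      rw [Real.sqrt_le_left (by linarith)]
      nlinarith
    have t2 : L ≤ K₂ * ℓ * √r := h1.trans (le_mul_of_one_le_right (by linarith) hsr1)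
    linarith
  have h6 : r ≤ 2 * (p : ℝ) ^ (2 + τ) := projDim_le hτ hp
  have hL0 : 0 ≤ √(2 * r * L) + L := by
    have : 0 < L := Real.log_pos (by rw [lt_div_iff₀ (hδ p).1]; linarith [(hδ p).2])
    positivity
  calc _ ≤ √r * (4 * (K₁ * p) / (p : ℝ) ^ γ * (3 * K₂ * ℓ * √r) / ((p : ℝ) ^ α / 2)) := by
        gcongr
        exact h3.1
    _ = 24 * K₁ * K₂ * ℓ * (√r * √r) * (p / ((p : ℝ) ^ γ * (p : ℝ) ^ α)) := by
        field_simp; ring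
    _ ≤ 24 * K₁ * K₂ * ℓ * (2 * (p : ℝ) ^ (2 + τ)) * (p / ((p : ℝ) ^ γ * (p : ℝ) ^ α)) := by
        rw [Real.mul_self_sqrt (by linarith)]
        gcongr
    _ = 48 * K₁ * K₂ * (ℓ ^ 1 * (p : ℝ) ^ (2 + τ + 1 - (γ + α))) := by
        rw [Real.rpow_sub hp0, Real.rpow_add hp0 (2 + τ), Real.rpow_one, Real.rpow_add hp0 γ]
        ring
    _ ≤ _ := by
        gcongr
        linarith

/-- The square is p (log p)² w²/n, which is at most the product of the two given null sequences: the
factors √r cancel. -/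
lemma tendsto_log_mul_sqrt_mul {n r : ℕ → ℕ} {w : ℕ → ℝ} (hw : ∀ᶠ p in atTop, 0 < w p)
    (hr : ∀ᶠ p in atTop, 0 < r p)
    (h1 : Tendsto (fun p : ℕ => p * Real.log p ^ 3 / √(r p : ℝ)) atTop (𝓝 0))
    (h2 : Tendsto (fun p : ℕ => √(r p : ℝ) * (w p ^ 2 / n p)) atTop (𝓝 0)) :
    Tendsto (fun p : ℕ => Real.log p * (√p * (w p / √(n p)))) atTop (𝓝 0) := by
  have h3 := (h1.mul h2).sqrt
  rw [mul_zero, Real.sqrt_zero] at h3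
  refine squeeze_zero' ?_ ?_ h3
  · filter_upwards [hw] with p hp
    have : 0 ≤ Real.log p := Real.log_natCast_nonneg p
    positivity
  · filter_upwards [hw, hr, tendsto_log_natCast.eventually_ge_atTop 1] with p hp hrp hl
    have hr0 : (0 : ℝ) < r p := by exact_mod_cast hrp
    have hsr := Real.sqrt_pos.2 hr0
    apply Real.le_sqrt_of_sq_le
    have h4 : (Real.log p * (√p * (w p / √(n p)))) ^ 2
        = p * Real.log p ^ 2 * (w p ^ 2 / n p) := by
      rw [mul_pow, mul_pow, div_pow, Real.sq_sqrt (Nat.cast_nonneg _),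
        Real.sq_sqrt (Nat.cast_nonneg _)]
      ring
    rw [h4]
    calc _ ≤ p * Real.log p ^ 3 * (w p ^ 2 / n p) := by
          gcongr
          norm_num
      _ = _ := by field_simp

lemma eventually_regime {n s₀ r : ℕ → ℕ} {σ w : ℕ → ℝ} {σ₁ : ℝ} (hσ₁ : 0 < σ₁)
    (hσ : ∀ᶠ p in atTop, σ₁ ≤ σ p) (hr : Tendsto r atTop atTop)
    (hrn : ∀ᶠ p in atTop, r p ≤ n p) (hs : ∀ᶠ p in atTop, s₀ p ≤ p)
    (hw : ∀ᶠ p in atTop, 0 < w p)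
    (h : Tendsto (fun p : ℕ => √(r p : ℝ) * (w p ^ 2 / n p)) atTop (𝓝 0)) :
    ∀ᶠ p in atTop, Regime p (n p) (s₀ p) (r p) (σ p) (w p) := by
  filter_upwards [hσ, hr.eventually_ge_atTop 1, hrn, hs, hw, h.eventually_le_const hσ₁,
    h.eventually_le_const one_pos, tendsto_log_natCast.eventually_ge_atTop 1]
    with p h1 h2 h3 h4 h5 h6 h7 h8
  have hr0 : (1 : ℝ) ≤ r p := by exact_mod_cast h2
  have hsr : 1 ≤ √(r p : ℝ) := Real.one_le_sqrt.2 hr0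
  have hn0 : (0 : ℝ) < n p := by
    have : (r p : ℝ) ≤ n p := by exact_mod_cast h3
    linarith
  refine ⟨h8, h2, h3, h4, hσ₁.trans_le h1, h5, ?_, ?_⟩
  · have : w p ^ 2 / n p ≤ 1 :=
      (le_mul_of_one_le_left (by positivity) hsr).trans h7
    rwa [div_le_one hn0] at this
  · rw [le_div_iff₀ (by linarith), mul_comm]
    exact h6.trans h1

/-! ### The growth conditions -/

lemma isLittleO_of_le_mul {f g ε : ℕ → ℝ} (hε : Tendsto ε atTop (𝓝 0))
    (hf : ∀ᶠ p in atTop, 0 ≤ f p) (h : ∀ᶠ p in atTop, f p ≤ ε p * g p) : f =o[atTop] g := by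
  rw [isLittleO_iff]
  intro c hc
  have h1 : ∀ᶠ p in atTop, |ε p| ≤ c := by
    have := hε.abs
    rw [abs_zero] at this
    exact this.eventually_le_const hc
  filter_upwards [hf, h, h1] with p h2 h3 h4
  rw [Real.norm_eq_abs, Real.norm_eq_abs, abs_of_nonneg h2]
  calc f p ≤ |ε p * g p| := h3.trans (le_abs_self _)
    _ = |ε p| * |g p| := abs_mul _ _
    _ ≤ _ := by gcongr

theorem sufficientConditions_of_regime {n s₀ r : ℕ → ℕ} {σ w : ℕ → ℝ} {σ₁ : ℝ} (hσ₁ : 0 < σ₁)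
    (hσ : ∀ᶠ p in atTop, σ₁ ≤ σ p)
    (hreg : ∀ᶠ p in atTop, Regime p (n p) (s₀ p) (r p) (σ p) (w p))
    (h1 : Tendsto (fun p : ℕ => p * Real.log p ^ 3 / √(r p : ℝ)) atTop (𝓝 0))
    (h2 : Tendsto (fun p : ℕ => Real.log p * (√p * (w p / √(n p)))) atTop (𝓝 0)) :
    SufficientConditions 1 σ n s₀ r w where
  compatibility := by
    refine isLittleO_of_le_mul (ε := fun p => 9 * (p * Real.log p ^ 3 / √(r p : ℝ)))
      (by simpa using h1.const_mul 9) ?_ (hreg.mono fun p hp => hp.compatibility_le)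
    filter_upwards [hreg] with p hp
    have := hp.one_le_phiW
    positivity
  penalty_level := by
    refine IsBigO.of_bound 1 ?_
    filter_upwards [hreg, h2.eventually_le_const one_pos] with p hp h3
    rw [one_mul, Real.norm_eq_abs, Real.norm_eq_abs, abs_of_nonneg (Real.sqrt_nonneg _)]
    refine (hp.penalty_level_le ?_).trans (le_abs_self _)
    have hw := hp.w_pos
    exact (le_mul_of_one_le_left (by positivity) hp.one_le_log).trans h3
  sparsity := by
    refine isLittleO_of_le_mul (ε := fun p => 1 / σ₁ * (Real.log p * (√p * (w p / √(n p)))))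
      (by simpa using h2.const_mul (1 / σ₁)) ?_ ?_
    · filter_upwards [hreg] with p hp
      exact mul_nonneg hp.inv_rho_nonneg (Real.sqrt_nonneg _)
    · filter_upwards [hreg, hσ] with p hp h3
      refine hp.sparsity_le.trans ?_
      have hw := hp.w_pos
      have hl := hp.log_pos
      gcongr
  error := by
    refine isLittleO_of_le_mul (ε := fun p => 36 * (p * Real.log p ^ 3 / √(r p : ℝ)))
      (by simpa using h1.const_mul 36) ?_ (hreg.mono fun p hp => hp.error_le)
    filter_upwards [hreg] with p hp
    have h3 := hp.one_le_phiW
    have h4 := hp.penalty_pos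
    have h5 := hp.inv_rho_nonneg
    positivity

lemma tendsto_failure_probability :
    Tendsto (fun p : ℕ => ENNReal.ofReal (((p : ℝ) * p + p + (p + 2) * (p + 2)) *
      (4 * Real.exp (-(Real.log p ^ 2 / 16))))) atTop (𝓝 0) := by
  have hlim : Tendsto (fun p : ℕ => 44 * Real.exp (-Real.log p)) atTop (𝓝 0) := by
    simpa using (Real.tendsto_exp_neg_atTop_nhds_zero.comp tendsto_log_natCast).const_mul 44
  rw [← ENNReal.ofReal_zero]
  refine ENNReal.tendsto_ofReal (squeeze_zero' (Eventually.of_forall fun p => by positivity) ?_ hlim)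
  -- Threshold 48 = 3 · 16: from there on (log p)²/16 ≥ 3 log p, which beats the factor p² and
  -- leaves 1/p.
  filter_upwards [tendsto_log_natCast.eventually_ge_atTop 48, eventually_ge_atTop 1] with p hl hp
  have hp1 : (1 : ℝ) ≤ p := by exact_mod_cast hp
  have h1 : ((p : ℝ) * p + p + (p + 2) * (p + 2)) ≤ 11 * (p : ℝ) ^ 2 := by nlinarith
  have h2 : (p : ℝ) ^ 2 = Real.exp (2 * Real.log p) := by
    rw [← Real.rpow_natCast, Real.rpow_def_of_pos (by linarith)]
    push_cast
    ring_nf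
  calc _ ≤ 11 * (p : ℝ) ^ 2 * (4 * Real.exp (-(Real.log p ^ 2 / 16))) := by gcongr
    _ = 44 * Real.exp (2 * Real.log p + -(Real.log p ^ 2 / 16)) := by
        rw [h2, Real.exp_add]; ring
    _ ≤ _ := by
        gcongr
        nlinarith

end JLDebias

/-! ### Choice of the projection dimension and conclusion -/

theorem mainTheorem6 :
    -- the absolute constant in the Lasso penalty
    ∃ C : ℝ, 0 < C ∧
    -- the asymptotic regime, all parameters being functions of `p`
    ∀ (c₀ α γ : ℝ) (n s₀ : ℕ → ℕ) (δ : ℕ → ℝ),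
      0 < c₀ → c₀ < 1 → 2 < α → 3 < α + γ →
      (∀ p : ℕ, |(n p : ℝ) - (p : ℝ) ^ α| ≤ 1) →
      (∀ p : ℕ, |(s₀ p : ℝ) - c₀ * p| ≤ 1) →
      (∀ p : ℕ, 0 < δ p ∧ δ p < 1) →
      ((fun p : ℕ => Real.log (1 / δ p)) =O[atTop] fun p : ℕ => Real.log p) →
    -- the projection dimension
    ∃ r : ℕ → ℕ, Tendsto r atTop atTop ∧
    -- the entry distribution, the noise level and truncation, and the privacy parameter
    ∀ (D : Measure ℝ) (b : ℝ) (σ bn w : ℕ → ℝ),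
      IsProbabilityMeasure D →
      (∀ᵐ x ∂D, |x| ≤ b) → ∫ x, x ∂D = 0 → ProbabilityTheory.variance id D = 1 →
      (∀ p : ℕ, 0 < σ p) → (σ =Θ[atTop] fun _ => (1 : ℝ)) →
      (bn =O[atTop] fun p : ℕ => σ p * √(Real.log (n p))) →
      Tendsto (fun p : ℕ => bn p / σ p - √(2 * Real.log (2 * n p))) atTop atTop →
      (∀ p : ℕ, w p =
        JLDebias.privacyW (JLDebias.rowBound p (s₀ p) b (bn p)) ((p : ℝ) ^ γ) (δ p) (r p)) →
    JLDebias.SufficientConditions C σ n s₀ r w ∧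
    -- the linear model, the projection and the private Lasso
    ∀ (Ω : ℕ → Type*) [∀ p, MeasurableSpace (Ω p)] (μ : ∀ p, Measure (Ω p))
      [∀ p, IsProbabilityMeasure (μ p)]
      (X : ∀ p, Ω p → Matrix (Fin (n p)) (Fin p) ℝ)
      (ξ : ∀ p, Ω p → Fin (n p) → ℝ)
      (R : ∀ p, Ω p → Matrix (Fin (r p)) (Fin (n p) ⊕ (Fin p ⊕ Unit)) ℝ)
      (θ₀ : ∀ p : ℕ, Fin p → ℝ) (y : ∀ p, Ω p → Fin (n p) → ℝ)
      (θhat : ∀ p, Ω p → Fin p → ℝ),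
      (∀ᶠ p in atTop, JLDebias.IsModel (μ p) D (σ p) (bn p) (X p) (ξ p) (R p)) →
      (∀ᶠ p in atTop, ∑ j, θ₀ p j ^ 2 = 1) →
      (∀ᶠ p in atTop, {j | θ₀ p j ≠ 0}.ncard = s₀ p) →
      (∀ p ω, y p ω = (X p ω).mulVec (θ₀ p) + ξ p ω) →
      (∀ᶠ p in atTop, ∀ᵐ ω ∂(μ p), JLDebias.IsPrivateLasso
        (JLDebias.penalty C (σ p) (n p) p (r p)) (w p) (X p ω) (y p ω) (R p ω) (θhat p ω)) →
      -- the sup norm of the bias is of smaller order, in probability, than `σ ρ`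
      ∀ η : ℝ, 0 < η →
        Tendsto (fun p : ℕ => μ p {ω |
            η < ‖JLDebias.bias (w p) (X p ω) (R p ω) (θ₀ p) (θhat p ω)‖ /
              (σ p * JLDebias.rho (n p) (r p) (w p))})
          atTop (𝓝 0) := by
  -- The constant 1 suffices because the ℓ¹ bound does not require λ to dominate the noise.
  refine ⟨1, one_pos, ?_⟩
  intro c₀ α γ n s₀ δ hc₀ hc₁ hα hαγ hn hs hδ hδO
  -- Halving leaves room on both sides: r is strictly below n in order, and √r w²/n decays like a
  -- power of p. Only α and γ enter, so r does not depend on the distributions.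
  set τ : ℝ := min (α + γ - 3) (α - 2) / 2 with hτdef
  have hτm : 0 < min (α + γ - 3) (α - 2) := lt_min (by linarith) (by linarith)
  have hτ : 0 < τ := by positivity
  have hτγ : 2 * τ ≤ α + γ - 3 := by
    have := min_le_left (α + γ - 3) (α - 2)
    linarith
  have hτα : 2 + τ < α := by
    have := min_le_right (α + γ - 3) (α - 2)
    linarith
  refine ⟨JLDebias.projDim τ, JLDebias.tendsto_projDim hτ, ?_⟩
  intro D b σ bn w hprob hD hD0 hD1 hσ hσΘ hbnO hbnT hw
  have hb := JLDebias.pos_of_variance_eq_one hD hD0 hD1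
  obtain ⟨σ₂, hσ₂⟩ : ∃ σ₂ : ℝ, ∀ᶠ p in atTop, σ p ≤ σ₂ := by
    obtain ⟨c, hc⟩ := hσΘ.1.bound
    refine ⟨c, hc.mono fun p hp => ?_⟩
    rw [norm_one, mul_one] at hp
    exact (le_abs_self _).trans hp
  obtain ⟨σ₁, hσ₁, hσ₁σ⟩ : ∃ σ₁ : ℝ, 0 < σ₁ ∧ ∀ᶠ p in atTop, σ₁ ≤ σ p := by
    obtain ⟨c, hc0, hc⟩ := hσΘ.2.exists_pos
    refine ⟨1 / c, by positivity, hc.bound.mono fun p hp => ?_⟩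
    rw [norm_one, Real.norm_eq_abs, abs_of_pos (hσ p)] at hp
    rw [div_le_iff₀ hc0]
    linarith
  obtain ⟨K, hK, hbnK⟩ := JLDebias.exists_truncation_le (by linarith) hn hσ hσ₂ hbnO
  have hbn0 := JLDebias.eventually_truncation_pos hσ hbnT
  obtain ⟨K₂, hK₂, hδK⟩ := JLDebias.exists_log_four_div_le hδ hδO
  have hsp := JLDebias.eventually_sparsity_le hc₁ hs
  have hB := JLDebias.eventually_rowBound_sq_le hb.le hsp hbnK hbn0
  have hwpos : ∀ᶠ p in atTop, 0 < w p := by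
    filter_upwards [eventually_ge_atTop 1] with p hp
    rw [hw]
    have hp0 : (0 : ℝ) < p := by exact_mod_cast hp
    exact JLDebias.privacyW_pos (JLDebias.rowBound_pos hp _ hb _) (Real.rpow_pos_of_pos hp0 _)
      (hδ p).1 (hδ p).2 _
  have hrpos : ∀ᶠ p in atTop, 0 < JLDebias.projDim τ p :=
    (JLDebias.tendsto_projDim hτ).eventually_ge_atTop 1
  have hlim₁ := JLDebias.tendsto_mul_log_pow_div_sqrt_projDim hτ
  have hlimW := JLDebias.tendsto_sqrt_projDim_mul hτ (by linarith) hτγ hn hδ (by positivity) hK₂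
    hδK hB hw
  have hlim₂ := JLDebias.tendsto_log_mul_sqrt_mul hwpos hrpos hlim₁ hlimW
  have hreg := JLDebias.eventually_regime hσ₁ hσ₁σ (JLDebias.tendsto_projDim hτ)
    (JLDebias.eventually_projDim_le hτ hτα hn) hsp hwpos hlimW
  refine ⟨JLDebias.sufficientConditions_of_regime hσ₁ hσ₁σ hreg hlim₁ hlim₂, ?_⟩
  intro Ω _ μ _ X ξ R θ₀ y θhat hM hθ₀ _ hy hθ η hη
  have hlim₃ : Tendsto (fun p : ℕ => 1 / σ₁ *
      (8 * (b ^ 2 + 1) * (b * K + (b + 1) * (K + 2) + 2 * σ₂) *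
          (p * Real.log p ^ 3 / √(JLDebias.projDim τ p : ℝ))
        + 2 * (b + 1) * (Real.log p * (√p * (w p / √(n p)))))) atTop (𝓝 0) := by
    simpa using ((hlim₁.const_mul _).add (hlim₂.const_mul _)).const_mul (1 / σ₁)
  have hlim₄ := hlim₁.const_mul (b ^ 2 + 1)
  rw [mul_zero] at hlim₄
  refine tendsto_of_tendsto_of_tendsto_of_le_of_le' tendsto_const_nhds
    JLDebias.tendsto_failure_probability (Eventually.of_forall fun p => zero_le) ?_
  filter_upwards [hM, hθ₀, hθ, hreg, hbnK, hbn0, hσ₁σ, hσ₂, hlim₃.eventually_le_const hη,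
    hlim₄.eventually_le_const (by norm_num : (0 : ℝ) < 1 / 4), hlim₁.eventually_le_const one_pos,
    eventually_ge_atTop 1] with p hM hθ₀ hθ hreg hbnK hbn0 hσ₁σ hσ₂ h₃ h₄ h₁ hp
  have hℓr : Real.log p ≤ √(JLDebias.projDim τ p : ℝ) := by
    rw [div_le_one hreg.sqrt_r_pos] at h₁
    have h5 : Real.log p ≤ Real.log p ^ 3 := le_self_pow₀ hreg.one_le_log (by norm_num)
    nlinarith [hreg.one_le_p, hreg.log_pos]
  refine le_trans ?_ (hM.measure_not_isGood_le (hreg.r_pos.trans_le hreg.r_le) hreg.r_pos hb hbn0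
    hreg.log_pos.le hℓr hD hD0 hD1 (w p) (θ₀ p))
  -- Almost-everywhere inclusion of the bad bias event in the failure of the good event; no
  -- measurability of the chosen minimizer is needed, and minimality is only assumed almost surely.
  refine measure_mono_ae ?_
  filter_upwards [hθ] with ω hω hbad hgood
  rw [hy] at hω
  exact absurd hbad (not_lt.2 ((hreg.norm_bias_div_le hb.le hbn0.le hbnK hσ₁ hσ₁σ hσ₂ h₄ hgood hθ₀
    hω).trans h₃))
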